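/- Let $d\ge 0$ and let $F:\mathbb{R}^d\to\mathbb{R}$ be $C^3$ and $\mathbb{Z}^d$-periodic with $F(0)=0$, $F(x)>0$ for $x\notin\mathbb{Z}^d$, and $D^2F(0)$ positive definite. Put $\mathbb{T}^d=\mathbb{R}^d/\mathbb{Z}^d$, $|x|_{\mathbb{T}}=\min_{k\in\mathbb{Z}^d}|x+k|$, $h(y,x)=\frac12|x-y|^2+F(y)$, and let $\psi$ be the continuous $\mathbb{Z}^d$-periodic function with $\psi(0)=0$ and $\psi(x)=\min_{y\in\mathbb{R}^d}\{\psi(y)+h(y,x)\}$ for all $x$. Let $\Phi(x,p)=(x+p+\nabla F(x),\,p+\nabla F(x))$ on $\mathbb{R}^d\times\mathbb{R}^d$, and let $\Phi_{\mathbb{T}}$ be the induced map of $\mathbb{T}^d\times\mathbb{R}^d$. Let $\mathcal{D}(\psi)\subset\mathbb{R}^d$ be the set of points where $\psi$ is differentiable, $\mathcal{D}_{\mathbb{T}}(\psi)$ its projection to $\mathbb{T}^d$, $\mathcal{G}_\psi=\{(x,\nabla\psi(x)):x\in\mathcal{D}(\psi)\}$, and $\mathcal{D}^-(\psi)=\pi_1\Phi^{-1}(\overline{\mathcal{G}_\psi})$,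 where $\pi_1(x,p)=x$. For $\varepsilon>0$ let $W^u_{\mathrm{loc}}=W^u_{\mathrm{loc}}(\varepsilon)$ be the set of $z\in\mathbb{T}^d\times\mathbb{R}^d$ such that $\Phi_{\mathbb{T}}^{-n}z$ has distance less than $\varepsilon$ from $(0,0)$ for all $n\ge0$ and $\Phi_{\mathbb{T}}^{-n}z\to(0,0)$ as $n\to\infty$; here the distance on $\mathbb{T}^d\times\mathbb{R}^d$ is the maximum of the $|\cdot|_{\mathbb{T}}$-distance and the Euclidean distance. Then $(0,0)$ is a hyperbolic fixed point of $\Phi_{\mathbb{T}}$, and there is $\varepsilon_0>0$, depending only on $F$, such that for every $\varepsilon\in(0,\varepsilon_0)$ there is $C>1$, depending only on $F$ and $\varepsilon$, for which the following hold. (1) $W^u_{\mathrm{loc}}$ is the projection to $\mathbb{T}^d\times\mathbb{R}^d$ of a graph $\{(x,w(x)):x\in V\}$, where $V\subset B_{1/2}(0)\subset\mathbb{R}^d$ is an open neighbourhood of $0$ and $w:V\to\mathbb{R}^d$ is $C^2$ with $|w|$, $\|Dw\|$, $\|D^2w\|\le C$ on $V$. Its tangent plane at $(0,0)$ is $\{(\eta,S^+\eta):\eta\in\mathbb{R}^d\}$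 for a positive definite symmetric matrix $S^+$. (2) There is $r>0$ such that $$\{(x,\nabla\psi(x)):x\in\mathcal{D}_{\mathbb{T}}(\psi),\ |x|_{\mathbb{T}}<r\}=W^u_{\mathrm{loc}}\cap\{(x,v):|x|_{\mathbb{T}}<r\},$$ $B_r(0)\subset\mathcal{D}^-(\psi)\subset\mathcal{D}(\psi)$, and $\psi$ is $C^3$ on $B_r(0)$ with second derivative bounded by $C$ there. Moreover $\psi(x)\ge C^{-1}|x|_{\mathbb{T}}^2$ for all $x$, and $|\sqrt{\psi(x)}-\sqrt{\psi(y)}|\le C|x-y|_{\mathbb{T}}$ for all $x,y$. (3) $\{(x,\nabla\psi(x)):x\in\mathcal{D}_{\mathbb{T}}(\psi)\}\subset\bigcup_{0\le k<C}\Phi_{\mathbb{T}}^k(W^u_{\mathrm{loc}})$. (4) There is $\kappa\in(0,1)$ such that for every $x\in\mathcal{D}(\psi)$ the function $y\mapsto\psi(y)+h(y,x)$ has a unique minimizer $\bar y(x)$, and $\psi(\bar y(x))\le\kappa^2\psi(x)$. -/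

import Mathlib

open Set Filter Topology

noncomputable section

namespace KickedHJ

/-- Euclidean space `ℝ^d`. -/
abbrev Space (d : ℕ) : Type := EuclideanSpace ℝ (Fin d)

/-- The integer lattice `ℤ^d` in `ℝ^d`. -/
def intLattice (d : ℕ) : AddSubgroup (Space d) where
  carrier := {x | ∀ i, ∃ n : ℤ, x i = n}
  zero_mem' := fun _ => ⟨0, by simp⟩
  add_mem' := by
    intro a b ha hb i
    obtain ⟨m, hm⟩ := ha i
    obtain ⟨n, hn⟩ := hb i
    exact ⟨m + n, by simp [hm, hn]⟩
  neg_mem' := by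
    intro a ha i
    obtain ⟨m, hm⟩ := ha i
    exact ⟨-m, by simp [hm]⟩

/-- The torus `𝕋^d = ℝ^d / ℤ^d`. Mathlib's quotient norm `‖(x : Torus d)‖` is
`|x|_𝕋 = min_k |x + k|`. -/
abbrev Torus (d : ℕ) : Type := Space d ⧸ intLattice d

/-- `ℤ^d`-periodicity. -/
def IsPeriodic {d : ℕ} {α : Type*} (f : Space d → α) : Prop :=
  ∀ x : Space d, ∀ k ∈ intLattice d, f (x + k) = f x

/-- The kick potential: `F` is `C³` and periodic, its only minimum on the torus is `0`, `F 0 = 0`,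
and its Hessian at `0` is positive definite. -/
structure IsKickPotential {d : ℕ} (F : Space d → ℝ) : Prop where
  contDiff : ContDiff ℝ 3 F
  periodic : IsPeriodic F
  map_zero : F 0 = 0
  pos : ∀ x : Space d, x ∉ intLattice d → 0 < F x
  hessian_pos : ∀ v : Space d, v ≠ 0 → 0 < fderiv ℝ (fderiv ℝ F) 0 v v

/-- The generating function `h(y, x) = |x - y|² / 2 + F(y)`. -/
def genFun {d : ℕ} (F : Space d → ℝ) (y x : Space d) : ℝ := ‖x - y‖ ^ 2 / 2 + F y

/-- `ψ` is the normalized stationary solution: continuous, periodic, `ψ 0 = 0`, and a fixed point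
of the Lax-Oleinik operator, `ψ x = min_y (ψ y + h(y, x))` (the minimum being attained). -/
structure IsStationarySolution {d : ℕ} (F ψ : Space d → ℝ) : Prop where
  continuous : Continuous ψ
  periodic : IsPeriodic ψ
  map_zero : ψ 0 = 0
  fixed : ∀ x : Space d, IsLeast (Set.range fun y => ψ y + genFun F y x) (ψ x)

/-- The set of minimizers of `y ↦ ψ y + h(y, x)`. -/
def minimizers {d : ℕ} (F ψ : Space d → ℝ) (x : Space d) : Set (Space d) :=
  {y | ∀ z, ψ y + genFun F y x ≤ ψ z + genFun F z x}

/-- The twist map `Φ(x, p) = (x + p + ∇F(x), p + ∇F(x))` of `ℝ^d × ℝ^d`, with its inverse. -/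
def twistMap {d : ℕ} (F : Space d → ℝ) : Space d × Space d ≃ Space d × Space d where
  toFun z := (z.1 + (z.2 + gradient F z.1), z.2 + gradient F z.1)
  invFun z := (z.1 - z.2, z.2 - gradient F (z.1 - z.2))
  left_inv z := by simp
  right_inv z := by simp

theorem gradient_add_of_mem {d : ℕ} {F : Space d → ℝ} (hF : IsPeriodic F) (x : Space d)
    {k : Space d} (hk : k ∈ intLattice d) : gradient F (x + k) = gradient F x := by
  have h : (fun y => F (y + k)) = F := funext fun y => hF y k hk
  have h2 := fderiv_comp_add_right (𝕜 := ℝ) (f := F) (x := x) k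
  rw [h] at h2
  simp only [gradient, h2]

/-- The gradient of a periodic function, as a function on the torus. -/
def torusGradient {d : ℕ} (F : Space d → ℝ) (hF : IsPeriodic F) : Torus d → Space d :=
  Quotient.lift (gradient F) (by
    intro a b hab
    have hk : -a + b ∈ intLattice d := QuotientAddGroup.leftRel_apply.mp hab
    have h := gradient_add_of_mem hF a hk
    rw [add_neg_cancel_left] at h
    exact h.symm)

/-- The map `Φ_𝕋` of `𝕋^d × ℝ^d` induced by the twist map, with its inverse. -/
def torusTwistMap {d : ℕ} (F : Space d → ℝ) (hF : IsPeriodic F) :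
    Torus d × Space d ≃ Torus d × Space d where
  toFun z := (z.1 + ((z.2 + torusGradient F hF z.1 : Space d) : Torus d),
    z.2 + torusGradient F hF z.1)
  invFun z := (z.1 - ((z.2 : Space d) : Torus d),
    z.2 - torusGradient F hF (z.1 - ((z.2 : Space d) : Torus d)))
  left_inv z := by simp
  right_inv z := by simp

/-- The covering map `ℝ^d × ℝ^d → 𝕋^d × ℝ^d`. -/
def proj {d : ℕ} (z : Space d × Space d) : Torus d × Space d := ((z.1 : Torus d), z.2)

/-- `Φ` is a lift of `Φ_𝕋`. -/
theorem torusTwistMap_proj {d : ℕ} (F : Space d → ℝ) (hF : IsPeriodic F) (z : Space d × Space d) :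
    torusTwistMap F hF (proj z) = proj (twistMap F z) := rfl

/-- The set `𝒟(ψ)` of points of differentiability. -/
def diffSet {d : ℕ} (ψ : Space d → ℝ) : Set (Space d) := {x | DifferentiableAt ℝ ψ x}

/-- The pseudograph `{(x, ∇ψ(x)) : x ∈ 𝒟(ψ)}` in `ℝ^d × ℝ^d`. -/
def pseudograph {d : ℕ} (ψ : Space d → ℝ) : Set (Space d × Space d) :=
  (fun x => (x, gradient ψ x)) '' diffSet ψ

/-- The pseudograph of a periodic function in `𝕋^d × ℝ^d`. -/
def torusPseudograph {d : ℕ} (ψ : Space d → ℝ) : Set (Torus d × Space d) :=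
  proj '' pseudograph ψ

/-- `𝒟⁻(ψ) = π₁ Φ⁻¹ (closure of the pseudograph)`. -/
def diffSetMinus {d : ℕ} (F ψ : Space d → ℝ) : Set (Space d) :=
  Prod.fst '' ((twistMap F).symm '' closure (pseudograph ψ))

/-- A continuous linear self-map is hyperbolic: the space splits into an invariant subspace that is
exponentially contracted and one that is mapped onto itself and exponentially expanded. -/
def IsHyperbolic {V : Type*} [NormedAddCommGroup V] [NormedSpace ℝ V] (L : V →L[ℝ] V) : Prop :=
  ∃ (Es Eu : Submodule ℝ V) (c q : ℝ), IsCompl Es Eu ∧ 0 < c ∧ 0 < q ∧ q < 1 ∧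
    Submodule.map (L : V →ₗ[ℝ] V) Es = Es ∧ Submodule.map (L : V →ₗ[ℝ] V) Eu = Eu ∧
    (∀ n : ℕ, ∀ v ∈ Es, ‖(L ^ n) v‖ ≤ c * q ^ n * ‖v‖) ∧
    (∀ n : ℕ, ∀ v ∈ Eu, ‖v‖ ≤ c * q ^ n * ‖(L ^ n) v‖)

/-- The local unstable manifold of size `ε` of a fixed point `p` of an invertible map: the points
whose whole backward orbit stays within distance less than `ε` of `p` and converges to `p`. -/
def localUnstable {X : Type*} [PseudoMetricSpace X] (f : X ≃ X) (p : X) (ε : ℝ) : Set X :=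
  {z | (∀ n : ℕ, dist ((f.symm : X → X)^[n] z) p < ε) ∧
    Tendsto (fun n : ℕ => (f.symm : X → X)^[n] z) atTop (𝓝 p)}

end KickedHJ

end

open KickedHJ

/-! The momentum of an orbit of `twistMap` is the difference of successive positions, so backward
orbits are solutions of vₙ₊₂ = 2vₙ₊₁ - vₙ + ∇F(vₙ₊₁).

Unstable manifold. On the Banach space of convergent sequences, the map sending a sequence to its
initial term and its residual in this recurrence is C². Its derivative at 0 is invertible because
the Hessian A of F at 0 is positive definite, so ‖(2 + A)⁻¹‖ < 1/2 (`orbitLin_bijective`). The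
inverse function theorem gives a C² family u of small backward orbits indexed by their initial
position (`exists_backwardOrbits`), and W^u is the graph of w(x) = x - u(x)₁. The tangent map of w
is 1 - L, where L + L⁻¹ = 2 + A and ‖L‖ < 1.

Stationary solution. If y minimizes ψ + h(·, x), then ψ(x) ≥ ψ(y) + F(y), F(y) ≥ c|y|² and 2ψ(y) ≤
|y|² in the torus norm; hence ψ contracts by (1 + 2c)⁻¹ along minimizers (`contraction`). Successive
minimizers form a backward orbit, and ψ controls both position and momentum, so (x, x - y) lies in
W^u once ψ(x) is small (`proj_mem_localUnstable`). Since ψ is bounded, a uniform number of backward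
steps suffices from anywhere, which gives the covering of the pseudograph.

Regularity. Near 0 each x is the minimizer for its own forward image x + w(x) + ∇F(x)
(`mem_minimizers_chartForward`). A point that is a minimizer is a point of differentiability,
because ψ is squeezed there between two smooth functions (`hasGradientAt_of_mem`). Hence ∇ψ = w near
0, and ψ is C³. -/

noncomputable section

namespace KickedHJ

/-! ### Smoothness of superposition operators on C(K, E) -/

section Superposition

variable {K E G : Type*} [TopologicalSpace K] [CompactSpace K]
  [NormedAddCommGroup E] [NormedSpace ℝ E] [NormedAddCommGroup G] [NormedSpace ℝ G]

/-- The superposition (Nemytskii) operator `u ↦ g ∘ u` on continuous functions. -/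
def superpose {K E G : Type*} [TopologicalSpace K] [NormedAddCommGroup E]
    [NormedAddCommGroup G] (g : C(E, G)) (u : C(K, E)) : C(K, G) := g.comp u

theorem continuous_superpose {K E G : Type*} [TopologicalSpace K] [NormedAddCommGroup E]
    [NormedAddCommGroup G] (g : C(E, G)) : Continuous (superpose (K := K) g) :=
  ContinuousMap.continuous_postcomp g

/-- A continuous family of operators acts pointwise on continuous functions. -/
def pointwiseCLM : C(K, E →L[ℝ] G) →L[ℝ] C(K, E) →L[ℝ] C(K, G) :=
  LinearMap.mkContinuous₂
    (LinearMap.mk₂ ℝ (fun (T : C(K, E →L[ℝ] G)) (v : C(K, E)) =>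
      (⟨fun k => T k (v k), T.continuous.clm_apply v.continuous⟩ : C(K, G)))
      (fun _ _ _ => by ext; simp) (fun _ _ _ => by ext; simp)
      (fun _ _ _ => by ext; simp) (fun _ _ _ => by ext; simp)) 1
    (fun T v => by
      rw [one_mul]
      refine (ContinuousMap.norm_le _ (by positivity)).2 fun k => ?_
      exact ((T k).le_opNorm _).trans (mul_le_mul (T.norm_coe_le_norm k) (v.norm_coe_le_norm k)
        (norm_nonneg _) (by positivity)))

@[simp] theorem pointwiseCLM_apply (T : C(K, E →L[ℝ] G)) (v : C(K, E)) (k : K) :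
    pointwiseCLM T v k = T k (v k) := rfl

/-- The mean value inequality on each segment from u k to u k + v k, with a modulus of continuity of
`g'` uniform in k. -/
theorem hasFDerivAt_superpose (g : C(E, G)) (g' : C(E, E →L[ℝ] G))
    (hg : ∀ x, HasFDerivAt g (g' x) x) (u : C(K, E)) :
    HasFDerivAt (superpose (K := K) g) (pointwiseCLM (superpose g' u)) u := by
  rw [hasFDerivAt_iff_isLittleO_nhds_zero, Asymptotics.isLittleO_iff]
  intro ε hε
  obtain ⟨δ, hδ, h⟩ := Metric.continuousAt_iff.1
    ((continuous_superpose (K := K) g').continuousAt (x := u)) ε hε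
  -- Uniformity in k comes from continuity of `superpose g'` at u, tested on perturbations by
  -- constant functions.
  have hclose : ∀ k : K, ∀ c : E, ‖c‖ < δ → ‖g' (u k + c) - g' (u k)‖ ≤ ε := by
    intro k c hc
    have h1 : dist (u + ContinuousMap.const K c) u < δ := by
      rw [dist_eq_norm, add_sub_cancel_left]
      exact (ContinuousMap.norm_lt_iff _ hδ).2 fun _ => hc
    have h2 := (h h1).le
    rw [dist_eq_norm, ContinuousMap.norm_le _ hε.le] at h2
    exact h2 k
  filter_upwards [Metric.ball_mem_nhds 0 hδ] with v hv
  rw [mem_ball_zero_iff] at hv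
  refine (ContinuousMap.norm_le _ (by positivity)).2 fun k => ?_
  have hvk : ‖v k‖ ≤ ‖v‖ := v.norm_coe_le_norm k
  have hconv := convex_segment (𝕜 := ℝ) (u k) (u k + v k)
  have key := hconv.norm_image_sub_le_of_norm_hasFDerivWithin_le'
    (f := g) (f' := fun x => g' x) (φ := g' (u k)) (C := ε)
    (fun x _ => (hg x).hasFDerivWithinAt) (fun x hx => by
      have hx' : ‖x - u k‖ ≤ ‖v k‖ := by
        rw [segment_eq_image'] at hx
        obtain ⟨t, ht, rfl⟩ := hx
        simp only [add_sub_cancel_left, norm_smul, Real.norm_eq_abs, abs_of_nonneg ht.1]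
        exact mul_le_of_le_one_left (norm_nonneg _) ht.2
      simpa using hclose k (x - u k) (by linarith))
    (left_mem_segment ℝ _ _) (right_mem_segment ℝ _ _)
  simp only [add_sub_cancel_left] at key
  exact key.trans (mul_le_mul_of_nonneg_left hvk hε.le)

/-- The derivative is a bounded linear map applied to the superposition operator of `fderiv ℝ g`, so
induction applies. The target changes from G to E →L[ℝ] G, hence the quantifier over G inside the
induction and the single universe. -/
theorem contDiff_superpose {K : Type} {E : Type} [TopologicalSpace K] [CompactSpace K]
    [NormedAddCommGroup E] [NormedSpace ℝ E] (n : ℕ) :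
    ∀ {G : Type} [NormedAddCommGroup G] [NormedSpace ℝ G] (g : C(E, G)),
      ContDiff ℝ n g → ContDiff ℝ n (superpose (K := K) g) := by
  induction n with
  | zero =>
    intro G _ _ g _
    exact contDiff_zero.2 (continuous_superpose g)
  | succ n ih =>
    intro G _ _ g hg
    push_cast at hg ⊢
    have hg1 : Differentiable ℝ g := hg.differentiable (by simp)
    have hg2 : ContDiff ℝ n (fderiv ℝ g) :=
      (contDiff_succ_iff_fderiv.1 hg).2.2
    have hd := hasFDerivAt_superpose (K := K) g ⟨fderiv ℝ g, hg2.continuous⟩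
      (fun x => (hg1 x).hasFDerivAt)
    refine contDiff_succ_iff_fderiv.2 ⟨fun u => (hd u).differentiableAt, by simp, ?_⟩
    rw [funext fun u => (hd u).fderiv]
    exact pointwiseCLM.contDiff.comp (ih ⟨fderiv ℝ g, hg2.continuous⟩ hg2)

end Superposition

/-! ### Spectral solution of L + L⁻¹ = 2 + A -/

section DiagonalOperator

variable {E ι : Type*} [NormedAddCommGroup E] [InnerProductSpace ℝ E] [Fintype ι]

/-- The operator that is diagonal in the orthonormal basis `b`, with eigenvalues `μ`. -/
def diagOp (b : OrthonormalBasis ι ℝ E) (μ : ι → ℝ) : E →L[ℝ] E :=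
  ∑ i, μ i • (innerSL ℝ (b i)).smulRight (b i)

theorem inner_diagOp (b : OrthonormalBasis ι ℝ E) (μ : ι → ℝ) (i : ι) (x : E) :
    inner ℝ (b i) (diagOp b μ x) = μ i * inner ℝ (b i) x := by
  classical
  simp [diagOp, inner_sum, inner_smul_right,
    orthonormal_iff_ite.1 b.orthonormal]

theorem ext_inner_basis (b : OrthonormalBasis ι ℝ E) {x y : E}
    (h : ∀ i, inner ℝ (b i) x = inner ℝ (b i) y) : x = y :=
  b.repr.injective (by ext i; simpa [b.repr_apply_apply] using h i)

theorem inner_diagOp_self (b : OrthonormalBasis ι ℝ E) (μ : ι → ℝ) (x : E) :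
    inner ℝ (diagOp b μ x) x = ∑ i, μ i * (inner ℝ (b i) x) ^ 2 := by
  rw [← b.sum_inner_mul_inner]
  refine Finset.sum_congr rfl fun i _ => ?_
  rw [real_inner_comm, inner_diagOp]
  ring

theorem inner_diagOp_comm (b : OrthonormalBasis ι ℝ E) (μ : ι → ℝ) (x y : E) :
    inner ℝ (diagOp b μ x) y = inner ℝ x (diagOp b μ y) := by
  rw [← b.sum_inner_mul_inner, ← b.sum_inner_mul_inner]
  refine Finset.sum_congr rfl fun i _ => ?_
  rw [real_inner_comm, inner_diagOp, inner_diagOp, real_inner_comm x]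
  ring

theorem inner_diagOp_self_pos (b : OrthonormalBasis ι ℝ E) {μ : ι → ℝ} (hμ : ∀ i, 0 < μ i)
    {x : E} (hx : x ≠ 0) : 0 < inner ℝ (diagOp b μ x) x := by
  rw [inner_diagOp_self]
  by_contra! h
  refine hx (ext_inner_basis b fun i => ?_)
  have h0 : ∀ j ∈ Finset.univ, 0 ≤ μ j * (inner ℝ (b j) x) ^ 2 :=
    fun j _ => mul_nonneg (hμ j).le (sq_nonneg _)
  have := (Finset.sum_eq_zero_iff_of_nonneg h0).1 (le_antisymm h (Finset.sum_nonneg h0)) i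
    (Finset.mem_univ i)
  rw [inner_zero_right]
  simpa [(hμ i).ne'] using this

theorem norm_diagOp_le (b : OrthonormalBasis ι ℝ E) {μ : ι → ℝ} {M : ℝ} (hM : 0 ≤ M)
    (hμ : ∀ i, |μ i| ≤ M) : ‖diagOp b μ‖ ≤ M := by
  refine ContinuousLinearMap.opNorm_le_bound _ hM fun x => ?_
  refine le_of_sq_le_sq ?_ (by positivity)
  rw [mul_pow, ← b.sum_sq_norm_inner_right, ← b.sum_sq_norm_inner_right, Finset.mul_sum]
  refine Finset.sum_le_sum fun i _ => ?_
  rw [inner_diagOp, norm_mul, mul_pow]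
  gcongr
  exact hμ i

/-- Everything is diagonal in an eigenbasis of A: G = L⁻¹, B = (2 + A)⁻¹ and M = (G - L)⁻¹. -/
theorem exists_spectral_root [FiniteDimensional ℝ E] (A : E →L[ℝ] E)
    (hA : ∀ x y, inner ℝ (A x) y = inner ℝ x (A y)) (hpos : ∀ v, v ≠ 0 → 0 < inner ℝ (A v) v) :
    ∃ (L G B M : E →L[ℝ] E) (q : ℝ), 0 < q ∧ q < 1 ∧ ‖L‖ ≤ q ∧ ‖B‖ ≤ q / 2 ∧
      (∀ v, L (G v) = v) ∧ (∀ v, G (L v) = v) ∧ (∀ v, L v + G v = (2 : ℝ) • v + A v) ∧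
      (∀ v, B ((2 : ℝ) • v + A v) = v) ∧ (∀ v, (2 : ℝ) • B v + A (B v) = v) ∧
      (∀ v, M (G v - L v) = v) ∧ (∀ v, G (M v) - L (M v) = v) ∧
      (∀ x y, inner ℝ (x - L x) y = inner ℝ x (y - L y)) ∧
      (∀ v, v ≠ 0 → 0 < inner ℝ (v - L v) v) := by
  have hsym : (A : E →ₗ[ℝ] E).IsSymmetric := fun x y => hA x y
  set b := hsym.eigenvectorBasis rfl with hb
  set l : Fin (Module.finrank ℝ E) → ℝ := hsym.eigenvalues rfl with hl
  have hbl : ∀ i, A (b i) = l i • b i := fun i => hsym.apply_eigenvectorBasis rfl i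
  have hlpos : ∀ i, 0 < l i := fun i => by
    have h1 := hpos (b i) (b.orthonormal.ne_zero i)
    rw [hbl, inner_smul_left, real_inner_self_eq_norm_sq, b.orthonormal.1 i] at h1
    simpa using h1
  have hAb : ∀ i x, inner ℝ (b i) (A x) = l i * inner ℝ (b i) x := fun i x => by
    rw [← hA, hbl, inner_smul_left]; simp
  -- The smaller root of m² - (2 + l)m + 1 = 0, which lies in (0, 1) because l > 0.
  set m : Fin (Module.finrank ℝ E) → ℝ := fun i => 1 + l i / 2 - √(l i + l i ^ 2 / 4) with hm
  have hm0 : ∀ i, 0 < m i := fun i => by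
    have h := hlpos i
    have : √(l i + l i ^ 2 / 4) < 1 + l i / 2 := by
      rw [Real.sqrt_lt' (by positivity)]; nlinarith
    simp only [hm]; linarith
  have hm1 : ∀ i, m i < 1 := fun i => by
    have h := hlpos i
    have : l i / 2 < √(l i + l i ^ 2 / 4) := by
      rw [Real.lt_sqrt (by positivity)]; nlinarith
    simp only [hm]; linarith
  have hmm : ∀ i, m i * m i + 1 = (2 + l i) * m i := fun i => by
    have h := hlpos i
    have := Real.mul_self_sqrt (show 0 ≤ l i + l i ^ 2 / 4 by positivity)
    simp only [hm]; nlinarith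
  have hmm' : ∀ i, m i + (m i)⁻¹ = 2 + l i := fun i => by
    have := (hm0 i).ne'
    field_simp; nlinarith [hmm i]
  have hdiff : ∀ i, (m i)⁻¹ - m i ≠ 0 := fun i => by
    have := (one_lt_inv₀ (hm0 i)).2 (hm1 i)
    have := hm1 i
    intro h0
    linarith
  -- Taking q close to 1, not as a maximum over i, also covers dimension 0.
  obtain ⟨q, hq0, hq1, hqm, hql⟩ : ∃ q : ℝ, 0 < q ∧ q < 1 ∧ (∀ i, m i ≤ q) ∧
      ∀ i, 2 / (2 + l i) ≤ q := by
    have hlt : ∀ i, max (m i) (2 / (2 + l i)) < 1 := fun i => max_lt (hm1 i) (by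
      rw [div_lt_one (by linarith [hlpos i])]; linarith [hlpos i])
    have h : ∀ᶠ q : ℝ in 𝓝[<] 1, 0 < q ∧ q < 1 ∧ ∀ i, max (m i) (2 / (2 + l i)) ≤ q := by
      have h1 : ∀ᶠ q : ℝ in 𝓝[<] 1, 0 < q :=
        nhdsWithin_le_nhds (lt_mem_nhds one_pos)
      have h2 : ∀ᶠ q : ℝ in 𝓝[<] 1, q < 1 := self_mem_nhdsWithin
      have h3 : ∀ᶠ q : ℝ in 𝓝[<] 1, ∀ i, max (m i) (2 / (2 + l i)) ≤ q :=
        eventually_all.2 fun i => nhdsWithin_le_nhds ((lt_mem_nhds (hlt i)).mono fun _ h => h.le)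
      filter_upwards [h1, h2, h3] with q a b c using ⟨a, b, c⟩
    obtain ⟨q, h0, h1, h2⟩ := h.exists
    exact ⟨q, h0, h1, fun i => (le_max_left _ _).trans (h2 i),
      fun i => (le_max_right _ _).trans (h2 i)⟩
  have hl2 : ∀ i, (2 + l i) ≠ 0 := fun i => by linarith [hlpos i]
  have hone : ∀ x, x - diagOp b m x = diagOp b (fun i => 1 - m i) x := fun x =>
    ext_inner_basis b fun i => by simp only [inner_sub_right, inner_diagOp]; ring
  refine ⟨diagOp b m, diagOp b fun i => (m i)⁻¹, diagOp b fun i => (2 + l i)⁻¹,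
    diagOp b fun i => ((m i)⁻¹ - m i)⁻¹, q, hq0, hq1, ?_, ?_, ?_, ?_, ?_, ?_, ?_, ?_, ?_, ?_, ?_⟩
  · exact norm_diagOp_le b hq0.le fun i => by rw [abs_of_pos (hm0 i)]; exact hqm i
  · refine norm_diagOp_le b (by positivity) fun i => ?_
    rw [abs_of_pos (inv_pos.2 (by linarith [hlpos i]))]
    have := hql i
    rw [div_eq_mul_inv] at this
    linarith
  · intro v
    refine ext_inner_basis b fun i => ?_
    simp only [inner_diagOp]
    rw [mul_inv_cancel_left₀ (hm0 i).ne']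
  · intro v
    refine ext_inner_basis b fun i => ?_
    simp only [inner_diagOp]
    rw [inv_mul_cancel_left₀ (hm0 i).ne']
  · intro v
    refine ext_inner_basis b fun i => ?_
    simp only [inner_diagOp, inner_add_right, inner_smul_right, hAb]
    rw [← add_mul, hmm', add_mul]
  · intro v
    refine ext_inner_basis b fun i => ?_
    simp only [inner_diagOp, inner_add_right, inner_smul_right, hAb]
    rw [← add_mul, inv_mul_cancel_left₀ (hl2 i)]
  · intro v
    refine ext_inner_basis b fun i => ?_
    simp only [inner_diagOp, inner_add_right, inner_smul_right, hAb]
    rw [← add_mul, mul_inv_cancel_left₀ (hl2 i)]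
  · intro v
    refine ext_inner_basis b fun i => ?_
    simp only [inner_diagOp, inner_sub_right]
    rw [← sub_mul, inv_mul_cancel_left₀ (hdiff i)]
  · intro v
    refine ext_inner_basis b fun i => ?_
    simp only [inner_diagOp, inner_sub_right]
    rw [← sub_mul, mul_inv_cancel_left₀ (hdiff i)]
  · intro x y
    rw [hone, hone, inner_diagOp_comm]
  · intro v hv
    rw [hone]
    exact inner_diagOp_self_pos b (fun i => sub_pos.2 (hm1 i)) hv

end DiagonalOperator

/-! ### Hyperbolicity of the linearized twist map -/

/-- The linear map `(x, p) ↦ (x + p + A x, p + A x)`. -/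
def linearTwist {E : Type*} [NormedAddCommGroup E] [NormedSpace ℝ E] (A : E →L[ℝ] E) :
    E × E →L[ℝ] E × E :=
  ((ContinuousLinearMap.fst ℝ E E + (ContinuousLinearMap.snd ℝ E E +
    A.comp (ContinuousLinearMap.fst ℝ E E))).prod
    (ContinuousLinearMap.snd ℝ E E + A.comp (ContinuousLinearMap.fst ℝ E E)))

section Hyperbolic

variable {E : Type*} [NormedAddCommGroup E] [NormedSpace ℝ E]

/-- The graph `{(x, x - R x)}` as a submodule. -/
def subGraph (R : E →L[ℝ] E) : Submodule ℝ (E × E) :=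
  LinearMap.range ((LinearMap.id).prod (LinearMap.id - (R : E →ₗ[ℝ] E)))

theorem mem_subGraph {R : E →L[ℝ] E} {z : E × E} : z ∈ subGraph R ↔ z.2 = z.1 - R z.1 := by
  constructor
  · rintro ⟨x, rfl⟩
    simp
  · intro h
    exact ⟨z.1, by ext <;> simp [h]⟩

/-- For p = x - R x the new position is 2x + A x - R x = T x and the new momentum is T x - x = T x -
R (T x): the graph is invariant and the dynamics on it is T = R⁻¹. -/
theorem linearTwist_pow_subGraph {A R T : E →L[ℝ] E} (hRT : ∀ v, R (T v) = v)
    (hsum : ∀ v, R v + T v = (2 : ℝ) • v + A v) (n : ℕ) (x : E) :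
    (linearTwist A ^ n) (x, x - R x) = ((T ^ n) x, (T ^ n) x - R ((T ^ n) x)) := by
  have step : ∀ x, linearTwist A (x, x - R x) = (T x, T x - R (T x)) := by
    intro x
    have h : A x = R x + T x - (2 : ℝ) • x := by rw [hsum]; abel
    ext1
    · simp [linearTwist, h, two_smul]; abel
    · simp [linearTwist, h, two_smul, hRT]; abel
  induction n with
  | zero => simp
  | succ n ih => rw [pow_succ', mul_apply_eq_comp, ih, step, pow_succ',
      mul_apply_eq_comp]

theorem map_linearTwist_subGraph {A R T : E →L[ℝ] E} (hRT : ∀ v, R (T v) = v)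
    (hTR : ∀ v, T (R v) = v)
    (hsum : ∀ v, R v + T v = (2 : ℝ) • v + A v) :
    Submodule.map (linearTwist A : E × E →ₗ[ℝ] E × E) (subGraph R) = subGraph R := by
  have step : ∀ x, linearTwist A (x, x - R x) = (T x, T x - R (T x)) := fun x => by
    simpa using linearTwist_pow_subGraph hRT hsum 1 x
  ext z
  simp only [Submodule.mem_map]
  constructor
  · rintro ⟨⟨x, p⟩, hy, rfl⟩
    obtain rfl : p = x - R x := mem_subGraph.1 hy
    rw [ContinuousLinearMap.coe_coe, step]
    exact mem_subGraph.2 rfl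
  · intro hz
    refine ⟨(R z.1, R z.1 - R (R z.1)), mem_subGraph.2 rfl, ?_⟩
    rw [ContinuousLinearMap.coe_coe, step, hTR]
    exact Prod.ext rfl (mem_subGraph.1 hz).symm

/-- The graph built from G carries the dynamics L and is stable; the graph built from L carries G
and is unstable. They are complementary because G - L is invertible. -/
theorem isHyperbolic_linearTwist {A L G M : E →L[ℝ] E} {q : ℝ} (hq0 : 0 < q) (hq1 : q < 1)
    (hL : ‖L‖ ≤ q) (hLG : ∀ v, L (G v) = v) (hGL : ∀ v, G (L v) = v)
    (hsum : ∀ v, L v + G v = (2 : ℝ) • v + A v) (hM : ∀ v, M (G v - L v) = v)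
    (hM' : ∀ v, G (M v) - L (M v) = v) : IsHyperbolic (linearTwist A) := by
  have hsum' : ∀ v, G v + L v = (2 : ℝ) • v + A v := fun v => by rw [add_comm, hsum]
  have hpow : ∀ (n : ℕ) x, ‖(L ^ n) x‖ ≤ q ^ n * ‖x‖ := by
    intro n x
    induction n with
    | zero => simp
    | succ n ih =>
      rw [pow_succ', mul_apply_eq_comp, pow_succ', mul_assoc]
      exact (L.le_of_opNorm_le hL _).trans (by gcongr)
  have hinv : ∀ (n : ℕ) x, (L ^ n) ((G ^ n) x) = x := by
    intro n
    induction n with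
    | zero => simp
    | succ n ih =>
      intro x
      rw [pow_succ, pow_succ', mul_apply_eq_comp, mul_apply_eq_comp,
        hLG, ih]
  have hgraph : ∀ (R : E →L[ℝ] E) x, ‖(x, x - R x)‖ ≤ (1 + ‖R‖) * ‖x‖ := fun R x => by
    have h1 := R.le_opNorm x
    refine max_le ?_ ((norm_sub_le _ _).trans (by linarith))
    nlinarith [norm_nonneg x, norm_nonneg R]
  set c := 1 + ‖L‖ + ‖G‖
  have hc : 0 < c := by positivity
  refine ⟨subGraph G, subGraph L, c, q, ⟨?_, ?_⟩, hc, hq0, hq1,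
    map_linearTwist_subGraph hGL hLG hsum', map_linearTwist_subGraph hLG hGL hsum, ?_, ?_⟩
  · rw [Submodule.disjoint_def]
    rintro ⟨x, p⟩ h1 h2
    have h1' : p = x - G x := mem_subGraph.1 h1
    have h2' : p = x - L x := mem_subGraph.1 h2
    have : G x - L x = 0 := by
      rw [h1', sub_right_inj] at h2'; rw [h2', sub_self]
    have hx : x = 0 := by rw [← hM x, this, map_zero]
    subst hx
    simp [h1']
  · rw [codisjoint_iff, Submodule.eq_top_iff']
    rintro ⟨x, p⟩
    rw [Submodule.mem_sup]
    set y := M (x - L x - p)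
    have hy : G y - L y = x - L x - p := hM' _
    refine ⟨(y, y - G y), mem_subGraph.2 rfl, (x - y, (x - y) - L (x - y)), mem_subGraph.2 rfl, ?_⟩
    ext1
    · simp
    · have : G y = x - L x - p + L y := by rw [← hy]; abel
      simp only [Prod.mk_add_mk, this, map_sub]
      abel
  · rintro n ⟨x, p⟩ hz
    obtain rfl : p = x - G x := mem_subGraph.1 hz
    rw [linearTwist_pow_subGraph hGL hsum']
    calc _ ≤ (1 + ‖G‖) * ‖(L ^ n) x‖ := hgraph G _
      _ ≤ c * (q ^ n * ‖x‖) := by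
        gcongr
        · simp only [c]; linarith [norm_nonneg L]
        · exact hpow n x
      _ ≤ c * q ^ n * ‖(x, x - G x)‖ := by
        rw [mul_assoc]
        gcongr
        exact le_max_left _ _
  · rintro n ⟨x, p⟩ hz
    obtain rfl : p = x - L x := mem_subGraph.1 hz
    rw [linearTwist_pow_subGraph hLG hsum]
    calc _ ≤ (1 + ‖L‖) * ‖x‖ := hgraph L _
      _ ≤ c * (q ^ n * ‖(G ^ n) x‖) := by
        gcongr
        · simp only [c]; linarith [norm_nonneg G]
        · simpa only [hinv] using hpow n ((G ^ n) x)
      _ ≤ _ := by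
        rw [mul_assoc]
        gcongr
        exact le_max_left _ _

end Hyperbolic

/-! ### Backward orbits by the inverse function theorem on convergent sequences -/

section SequenceSpace

variable {E : Type} [NormedAddCommGroup E] [NormedSpace ℝ E]

/-- The space of convergent sequences. -/
abbrev ConvSeq (E : Type) [TopologicalSpace E] : Type := C(OnePoint ℕ, E)

theorem tendsto_convSeq {E : Type} [TopologicalSpace E] (u : ConvSeq E) :
    Tendsto (fun n : ℕ => u n) atTop (𝓝 (u OnePoint.infty)) :=
  (OnePoint.continuous_iff_from_nat u).1 u.continuous

theorem convSeq_ext {E : Type} [NormedAddCommGroup E] {u v : ConvSeq E}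
    (h : ∀ n : ℕ, u n = v n) : u = v :=
  DFunLike.coe_injective
    (OnePoint.denseRange_coe.equalizer u.continuous v.continuous (funext h))

theorem norm_convSeq_le {E : Type} [NormedAddCommGroup E] {u : ConvSeq E} {C : ℝ} (hC : 0 ≤ C)
    (h : ∀ n : ℕ, ‖u n‖ ≤ C) : ‖u‖ ≤ C := by
  refine (ContinuousMap.norm_le _ hC).2 fun k => ?_
  induction k using OnePoint.rec with
  | infty => exact le_of_tendsto (tendsto_convSeq u).norm (Eventually.of_forall h)
  | coe n => exact h n

/-- The successor map of `ℕ ∪ {∞}`. -/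
def onePointSucc : C(OnePoint ℕ, OnePoint ℕ) :=
  OnePoint.continuousMapMkNat (fun n => ((n + 1 : ℕ) : OnePoint ℕ)) OnePoint.infty
    ((tendsto_add_atTop_iff_nat 1).2 (tendsto_convSeq (ContinuousMap.id _)))

variable (E) in
/-- The left shift of convergent sequences. -/
def shift : ConvSeq E →L[ℝ] ConvSeq E := ContinuousMap.compCLM ℝ E onePointSucc

@[simp] theorem shift_apply_natCast (u : ConvSeq E) (n : ℕ) : shift E u n = u (n + 1 : ℕ) := rfl

@[simp] theorem shift_apply_infty (u : ConvSeq E) : shift E u OnePoint.infty = u OnePoint.infty :=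
  rfl

theorem norm_shift_apply_le (u : ConvSeq E) : ‖shift E u‖ ≤ ‖u‖ :=
  norm_convSeq_le (norm_nonneg _) fun _ => u.norm_coe_le_norm _

/-- The sequence with a new first term. -/
def prepend {E : Type} [TopologicalSpace E] (x : E) (u : ConvSeq E) : ConvSeq E :=
  OnePoint.continuousMapMkNat (fun n => Nat.casesOn n x fun m => u m) (u OnePoint.infty)
    ((tendsto_add_atTop_iff_nat 1).1 (tendsto_convSeq u))

@[simp] theorem prepend_zero {E : Type} [NormedAddCommGroup E] (x : E) (u : ConvSeq E) :
    prepend x u ((0 : ℕ) : OnePoint ℕ) = x := rfl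

theorem norm_prepend_sub_le {E : Type} [NormedAddCommGroup E] (x : E) (u v : ConvSeq E) :
    ‖prepend x u - prepend x v‖ ≤ ‖u - v‖ := by
  refine norm_convSeq_le (norm_nonneg _) fun n => ?_
  cases n with
  | zero => simp
  | succ n => exact (u - v).norm_coe_le_norm n

variable (E) in
/-- The `n`-th term of a convergent sequence, as a continuous linear map. -/
def termCLM (n : ℕ) : ConvSeq E →L[ℝ] E := ContinuousMap.evalCLM ℝ (n : OnePoint ℕ)

/-- The operator `u ↦ (u₀, (2 uₙ₊₁ - uₙ - uₙ₊₂ + g uₙ₊₁)ₙ)`, whose zeros in the second component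
are the backward orbits of the twist map with kick `g`. -/
def orbitOp (g : C(E, E)) (u : ConvSeq E) : E × ConvSeq E :=
  (u ((0 : ℕ) : OnePoint ℕ),
    (2 : ℝ) • shift E u - u - shift E (shift E u) + superpose g (shift E u))

/-- The linearization of `orbitOp` at a fixed point. -/
def orbitLin (A : E →L[ℝ] E) : ConvSeq E →L[ℝ] E × ConvSeq E :=
  (termCLM E 0).prod
    ((2 : ℝ) • shift E - ContinuousLinearMap.id ℝ _ - (shift E).comp (shift E) +
      (pointwiseCLM (ContinuousMap.const _ A)).comp (shift E))

theorem orbitLin_eq_iff {A : E →L[ℝ] E} {v : ConvSeq E} {x : E} {f : ConvSeq E} :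
    orbitLin A v = (x, f) ↔ v ((0 : ℕ) : OnePoint ℕ) = x ∧ ∀ n : ℕ,
      (2 : ℝ) • v (n + 1 : ℕ) - v n - v (n + 2 : ℕ) + A (v (n + 1 : ℕ)) = f n := by
  rw [Prod.ext_iff]
  refine and_congr Iff.rfl ⟨fun h n => ?_, fun h => convSeq_ext fun n => ?_⟩
  · exact DFunLike.congr_fun h (n : OnePoint ℕ)
  · exact h n

theorem orbitOp_eq_iff {g : C(E, E)} {v : ConvSeq E} {x : E} :
    orbitOp g v = (x, 0) ↔ v ((0 : ℕ) : OnePoint ℕ) = x ∧ ∀ n : ℕ,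
      (2 : ℝ) • v (n + 1 : ℕ) - v n - v (n + 2 : ℕ) + g (v (n + 1 : ℕ)) = 0 := by
  rw [Prod.ext_iff]
  refine and_congr Iff.rfl ⟨fun h n => ?_, fun h => convSeq_ext fun n => ?_⟩
  · exact DFunLike.congr_fun h (n : OnePoint ℕ)
  · exact h n

theorem contDiff_orbitOp {g : C(E, E)} {n : ℕ} (hg : ContDiff ℝ n g) :
    ContDiff ℝ n (orbitOp g) := by
  refine (termCLM E 0).contDiff.prodMk ?_
  exact ((2 : ℝ) • shift E - ContinuousLinearMap.id ℝ _ -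
    (shift E).comp (shift E)).contDiff.add ((contDiff_superpose n g hg).comp (shift E).contDiff)

theorem hasFDerivAt_orbitOp {g : C(E, E)} (hg : ContDiff ℝ 1 g) :
    HasFDerivAt (orbitOp g) (orbitLin (fderiv ℝ g 0)) 0 := by
  refine (termCLM E 0).hasFDerivAt.prodMk ?_
  refine ((2 : ℝ) • shift E - ContinuousLinearMap.id ℝ _ -
    (shift E).comp (shift E)).hasFDerivAt.add ?_
  have h := hasFDerivAt_superpose (K := OnePoint ℕ) g
    ⟨fderiv ℝ g, hg.continuous_fderiv (by simp)⟩
    (fun x => (hg.differentiable (by simp) x).hasFDerivAt) (shift E 0)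
  have h2 := h.comp (0 : ConvSeq E) (shift E).hasFDerivAt
  rw [map_zero] at h2
  have h3 : superpose (⟨fderiv ℝ g, hg.continuous_fderiv (by simp)⟩ : C(E, E →L[ℝ] E)) 0 =
    ContinuousMap.const (OnePoint ℕ) (fderiv ℝ g 0) := rfl
  rw [h3] at h2
  exact h2

/-- Solving the recurrence for its middle term gives vₙ₊₁ = B(vₙ + vₙ₊₂ + fₙ) with v₀ = x. Since ‖B‖
≤ q/2, this is a fixed point problem for a q-contraction. -/
theorem orbitLin_bijective [CompleteSpace E] {A B : E →L[ℝ] E} {q : ℝ} (hq0 : 0 < q) (hq1 : q < 1)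
    (hB : ‖B‖ ≤ q / 2) (hBA : ∀ v, B ((2 : ℝ) • v + A v) = v)
    (hAB : ∀ v, (2 : ℝ) • B v + A (B v) = v) : Function.Bijective (orbitLin A) := by
  rw [Function.bijective_iff_existsUnique]
  rintro ⟨x, f⟩
  set T : ConvSeq E → ConvSeq E := fun v =>
    prepend x (pointwiseCLM (ContinuousMap.const _ B) (v + shift E (shift E v) + f)) with hT
  have hlip : ∀ v w, ‖T v - T w‖ ≤ q * ‖v - w‖ := by
    intro v w
    refine (norm_prepend_sub_le _ _ _).trans (norm_convSeq_le (by positivity) fun n => ?_)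
    have h0 : ‖(v - w + shift E (shift E (v - w))) n‖ ≤ 2 * ‖v - w‖ := by
      refine (ContinuousMap.norm_coe_le_norm _ _).trans ((norm_add_le _ _).trans ?_)
      linarith [(norm_shift_apply_le (shift E (v - w))).trans (norm_shift_apply_le (v - w))]
    have h1 : (pointwiseCLM (ContinuousMap.const _ B) (v + shift E (shift E v) + f) -
        pointwiseCLM (ContinuousMap.const _ B) (w + shift E (shift E w) + f)) (n : OnePoint ℕ) =
        B ((v - w + shift E (shift E (v - w))) n) := by
      simp only [ContinuousMap.sub_apply, pointwiseCLM_apply, ContinuousMap.const_apply, ← map_sub]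
      congr 1
      simp only [ContinuousMap.add_apply, shift_apply_natCast, ContinuousMap.sub_apply]
      abel
    rw [h1]
    refine (B.le_of_opNorm_le hB _).trans ?_
    nlinarith
  have hc : ContractingWith ⟨q, hq0.le⟩ T :=
    ⟨by exact_mod_cast hq1, LipschitzWith.of_dist_le_mul fun v w => by
      rw [dist_eq_norm, dist_eq_norm]; exact hlip v w⟩
  have hiff : ∀ v, orbitLin A v = (x, f) ↔ Function.IsFixedPt T v := by
    intro v
    rw [orbitLin_eq_iff]
    constructor
    · rintro ⟨h0, h1⟩
      refine convSeq_ext fun n => ?_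
      cases n with
      | zero => exact h0.symm
      | succ n =>
        change B (v n + v (n + 2 : ℕ) + f n) = v (n + 1 : ℕ)
        rw [← h1, ← hBA (v (n + 1 : ℕ))]
        congr 1
        rw [hBA]
        abel
    · intro h
      have h2 : ∀ n : ℕ, T v n = v n := fun n => by rw [h]
      refine ⟨(h2 0).symm, fun n => ?_⟩
      have h3 : B (v n + v (n + 2 : ℕ) + f n) = v (n + 1 : ℕ) := h2 (n + 1)
      have h4 := hAB (v n + v (n + 2 : ℕ) + f n)
      rw [h3] at h4
      rw [sub_add_eq_add_sub, sub_add_eq_add_sub, h4]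
      abel
  refine ⟨hc.fixedPoint T, (hiff _).2 hc.fixedPoint_isFixedPt, fun v hv => ?_⟩
  exact hc.fixedPoint_unique ((hiff v).1 hv)

/-- With 2 + A = L + G the recurrence factors: the defect eₙ = vₙ₊₁ - L vₙ satisfies eₙ = L eₙ₊₁. It
is bounded and ‖L‖ ≤ q < 1, so it vanishes. This identifies the tangent map of the unstable
manifold. -/
theorem apply_one_of_orbitLin {A L G : E →L[ℝ] E} {q : ℝ} (hq1 : q < 1)
    (hL : ‖L‖ ≤ q) (hLG : ∀ v, L (G v) = v) (hsum : ∀ v, L v + G v = (2 : ℝ) • v + A v)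
    {v : ConvSeq E} {x : E} (h : orbitLin A v = (x, 0)) : v ((1 : ℕ) : OnePoint ℕ) = L x := by
  obtain ⟨h0, h1⟩ := orbitLin_eq_iff.1 h
  set e : ConvSeq E := shift E v - pointwiseCLM (ContinuousMap.const _ L) v with he
  have hen : ∀ n : ℕ, e n = v (n + 1 : ℕ) - L (v n) := fun n => rfl
  have key : ∀ n : ℕ, e n = L (e (n + 1 : ℕ)) := by
    intro n
    have h2 : v (n + 2 : ℕ) = L (v (n + 1 : ℕ)) + G (v (n + 1 : ℕ)) - v n := by
      have h3 := h1 n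
      rw [ContinuousMap.zero_apply, sub_add_eq_add_sub, sub_add_eq_add_sub, sub_eq_zero] at h3
      rw [hsum, h3]
    rw [hen, hen, h2, map_sub, map_sub, map_add, hLG]
    abel
  have hle : ‖e‖ ≤ q * ‖e‖ := norm_convSeq_le
    (mul_nonneg ((norm_nonneg _).trans hL) (norm_nonneg _)) fun n => by
      rw [key]
      exact (L.le_of_opNorm_le hL _).trans (mul_le_mul_of_nonneg_left
        (e.norm_coe_le_norm _) ((norm_nonneg _).trans hL))
  have hz : e = 0 := by
    rw [← norm_le_zero_iff]
    nlinarith [norm_nonneg e]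
  have := hen 0
  rw [hz, h0] at this
  exact (sub_eq_zero.1 this.symm)

/-- The backward orbits near a hyperbolic fixed point form a `C²` family, parametrized by their
initial position. -/
theorem exists_backwardOrbits [CompleteSpace E] {g : E → E} (hg : ContDiff ℝ 2 g) (hg0 : g 0 = 0)
    {L G B : E →L[ℝ] E} {q : ℝ} (hq0 : 0 < q) (hq1 : q < 1) (hL : ‖L‖ ≤ q) (hB : ‖B‖ ≤ q / 2)
    (hLG : ∀ v, L (G v) = v) (hsum : ∀ v, L v + G v = (2 : ℝ) • v + fderiv ℝ g 0 v)
    (hBA : ∀ v, B ((2 : ℝ) • v + fderiv ℝ g 0 v) = v)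
    (hAB : ∀ v, (2 : ℝ) • B v + fderiv ℝ g 0 (B v) = v) :
    ∃ u : E → ConvSeq E, u 0 = 0 ∧ ContDiffAt ℝ 2 u 0 ∧
      HasFDerivAt (fun x => u x ((1 : ℕ) : OnePoint ℕ)) L 0 ∧
      (∀ᶠ x in 𝓝 0, u x ((0 : ℕ) : OnePoint ℕ) = x ∧
        ∀ n : ℕ, u x (n + 2 : ℕ) = (2 : ℝ) • u x (n + 1 : ℕ) - u x n + g (u x (n + 1 : ℕ))) ∧
      ∀ᶠ v in 𝓝 (0 : ConvSeq E),
        (∀ n : ℕ, v (n + 2 : ℕ) = (2 : ℝ) • v (n + 1 : ℕ) - v n + g (v (n + 1 : ℕ))) →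
        v = u (v ((0 : ℕ) : OnePoint ℕ)) := by
  set g' : C(E, E) := ⟨g, hg.continuous⟩
  have hg' : ContDiff ℝ 2 g' := hg
  set P := orbitOp g' with hP
  have hP0 : P 0 = 0 := orbitOp_eq_iff.2 ⟨rfl, fun n => by simp [g', hg0]⟩
  have hPc : ContDiff ℝ 2 P := contDiff_orbitOp (n := 2) hg'
  have hPd := hasFDerivAt_orbitOp (g := g') (hg'.of_le (by norm_num))
  set D : ConvSeq E ≃L[ℝ] E × ConvSeq E := ContinuousLinearEquiv.ofBijective
    (orbitLin (fderiv ℝ g 0))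
    (LinearMap.ker_eq_bot.2 (orbitLin_bijective hq0 hq1 hB hBA hAB).1)
    (LinearMap.range_eq_top.2 (orbitLin_bijective hq0 hq1 hB hBA hAB).2) with hD
  have hPD : HasFDerivAt P (D : ConvSeq E →L[ℝ] E × ConvSeq E) 0 := by
    rw [hD, ContinuousLinearEquiv.coe_ofBijective]
    exact hPd
  set e := hPc.contDiffAt.toOpenPartialHomeomorph P hPD (by norm_num) with he
  have heP : ∀ v, e v = P v := fun v => rfl
  have hmem : (0 : ConvSeq E) ∈ e.source :=
    hPc.contDiffAt.mem_toOpenPartialHomeomorph_source hPD (by norm_num)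
  have hmem' : (0 : E × ConvSeq E) ∈ e.target := by
    simpa [heP, hP0] using e.map_source hmem
  have hsymm0 : e.symm 0 = 0 := by
    have := e.left_inv hmem
    rwa [heP, hP0] at this
  have hQ : ContDiffAt ℝ 2 e.symm 0 := by
    have := hPc.contDiffAt.to_localInverse hPD (by norm_num)
    rwa [hP0] at this
  have hQd : HasFDerivAt e.symm (D.symm : E × ConvSeq E →L[ℝ] ConvSeq E) 0 := by
    refine e.hasFDerivAt_symm hmem' ?_
    rw [hsymm0]
    exact hPD
  set inc : E →L[ℝ] E × ConvSeq E := ContinuousLinearMap.inl ℝ E (ConvSeq E)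
  have hrec : ∀ v : ConvSeq E, (∀ n : ℕ, v (n + 2 : ℕ) =
      (2 : ℝ) • v (n + 1 : ℕ) - v n + g (v (n + 1 : ℕ))) ↔ ∀ n : ℕ,
      (2 : ℝ) • v (n + 1 : ℕ) - v n - v (n + 2 : ℕ) + g' (v (n + 1 : ℕ)) = 0 := by
    intro v
    refine forall_congr' fun n => ?_
    rw [sub_add_eq_add_sub, sub_add_eq_add_sub, sub_add_eq_add_sub, sub_eq_zero]
    exact eq_comm
  -- The local inverse is restricted to the slice of zero residual, leaving the initial position as
  -- parameter.
  refine ⟨fun x => e.symm (inc x), by simp [hsymm0], ?_, ?_, ?_, ?_⟩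
  · refine ContDiffAt.comp 0 ?_ inc.contDiff.contDiffAt
    rwa [map_zero]
  · have h1 : HasFDerivAt (fun x => e.symm (inc x))
        ((D.symm : E × ConvSeq E →L[ℝ] ConvSeq E).comp inc) 0 := by
      refine HasFDerivAt.comp (0 : E) ?_ inc.hasFDerivAt
      rwa [map_zero]
    have h2 := (termCLM E 1).hasFDerivAt.comp
      (0 : E) h1
    refine h2.congr_fderiv ?_
    ext x
    refine (apply_one_of_orbitLin hq1 hL hLG hsum (v := D.symm (inc x)) ?_)
    exact D.apply_symm_apply (inc x)
  · have h1 : ∀ᶠ x in 𝓝 (0 : E), inc x ∈ e.target :=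
      inc.continuous.continuousAt.eventually (by
        rw [map_zero]; exact e.open_target.mem_nhds hmem')
    filter_upwards [h1] with x hx
    rw [hrec]
    exact orbitOp_eq_iff.1 (e.right_inv hx)
  · filter_upwards [e.open_source.mem_nhds hmem] with v hv hv2
    rw [hrec] at hv2
    have h3 : e v = inc (v ((0 : ℕ) : OnePoint ℕ)) := orbitOp_eq_iff.2 ⟨rfl, hv2⟩
    rw [← h3, e.left_inv hv]

end SequenceSpace

/-! ### The quotient norm on the torus and lifts of small points -/

section TorusNorm

variable {d : ℕ}

theorem norm_torus_le (x : Space d) : ‖(x : Torus d)‖ ≤ ‖x‖ := QuotientAddGroup.norm_mk_le_norm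

theorem coe_eq_coe_iff {x y : Space d} :
    (x : Torus d) = y ↔ ∃ k ∈ intLattice d, y = x + k := by
  rw [QuotientAddGroup.eq]
  exact ⟨fun h => ⟨-x + y, h, by abel⟩, by rintro ⟨k, hk, rfl⟩; simpa⟩

theorem IsPeriodic.eq_of_coe_eq {α : Type*} {f : Space d → α} (hf : IsPeriodic f) {x y : Space d}
    (h : (x : Torus d) = y) : f x = f y := by
  obtain ⟨k, hk, rfl⟩ := coe_eq_coe_iff.1 h
  exact (hf x k hk).symm

theorem one_le_norm_of_mem {k : Space d} (hk : k ∈ intLattice d) (h0 : k ≠ 0) : 1 ≤ ‖k‖ := by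
  obtain ⟨i, hi⟩ : ∃ i, k i ≠ 0 := by
    by_contra! h
    exact h0 (by ext i; simpa using h i)
  obtain ⟨n, hn⟩ := hk i
  have h1 : (1 : ℝ) ≤ |k i| := by
    have hn' : k i = (n : ℝ) := hn
    rw [hn'] at hi ⊢
    have hn0 : n ≠ 0 := fun h => hi (by rw [h, Int.cast_zero])
    rw [← Int.cast_abs, ← Int.cast_one, Int.cast_le]
    exact Int.one_le_abs hn0
  exact h1.trans (PiLp.norm_apply_le k i)

theorem norm_torus_eq {x : Space d} (hx : ‖x‖ ≤ 1 / 2) : ‖(x : Torus d)‖ = ‖x‖ := by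
  refine le_antisymm (norm_torus_le x) (QuotientAddGroup.le_norm_iff.2 fun m hm => ?_)
  obtain ⟨k, hk, rfl⟩ := coe_eq_coe_iff.1 hm
  by_cases h0 : k = 0
  · simp [h0]
  · have h1 := one_le_norm_of_mem hk h0
    have h2 := norm_sub_le (m + k) m
    rw [add_sub_cancel_left] at h2
    linarith

theorem exists_lift_of_norm_lt {ξ : Torus d} {ε : ℝ} (h : ‖ξ‖ < ε) :
    ∃ x : Space d, (x : Torus d) = ξ ∧ ‖x‖ < ε := QuotientAddGroup.norm_lt_iff.1 h

theorem eq_of_coe_eq_of_norm {x y : Space d} (h : (x : Torus d) = y) (hxy : ‖x‖ + ‖y‖ < 1) :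
    x = y := by
  obtain ⟨k, hk, rfl⟩ := coe_eq_coe_iff.1 h
  by_contra h0
  have h1 := one_le_norm_of_mem hk (fun hk => h0 (by simp [hk]))
  have h2 := norm_sub_le (x + k) x
  rw [add_sub_cancel_left] at h2
  linarith

/-- Every point has a lattice translate in the unit cube. -/
theorem exists_coe_eq_norm_le (x : Space d) :
    ∃ y : Space d, (y : Torus d) = x ∧ ‖y‖ ≤ √d := by
  refine ⟨WithLp.toLp 2 fun i => Int.fract (x i), coe_eq_coe_iff.2
    ⟨WithLp.toLp 2 fun i => (⌊x i⌋ : ℝ), fun i => ⟨⌊x i⌋, rfl⟩, ?_⟩, ?_⟩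
  · ext i
    simp
  · rw [EuclideanSpace.norm_eq]
    refine Real.sqrt_le_sqrt ?_
    calc _ ≤ ∑ i : Fin d, (1 : ℝ) := Finset.sum_le_sum fun i _ => by
            rw [Real.norm_eq_abs, sq_abs]
            have h1 := Int.fract_nonneg (x i)
            have h2 := (Int.fract_lt_one (x i)).le
            exact pow_le_one₀ h1 h2
      _ = d := by simp

theorem not_mem_lattice_of_norm_pos {x : Space d} (h : 0 < ‖(x : Torus d)‖) :
    x ∉ intLattice d := fun hx => by
  rw [(QuotientAddGroup.eq_zero_iff x).2 hx, norm_zero] at h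
  exact h.false

end TorusNorm

/-! ### Growth of the kick potential -/

section Potential

variable {d : ℕ} {F : Space d → ℝ}

theorem inner_fderiv_gradient (F : Space d → ℝ) (v w : Space d) :
    inner ℝ (fderiv ℝ (gradient F) 0 v) w = fderiv ℝ (fderiv ℝ F) 0 v w := by
  have h : fderiv ℝ F = InnerProductSpace.toDual ℝ (Space d) ∘ gradient F := by
    ext x; simp
  rw [h, (InnerProductSpace.toDual ℝ (Space d)).comp_fderiv]
  rfl

namespace IsKickPotential

theorem nonneg (hF : IsKickPotential F) (x : Space d) : 0 ≤ F x := by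
  by_cases h : x ∈ intLattice d
  · have := hF.periodic 0 x h
    rw [zero_add, hF.map_zero] at this
    exact this.ge
  · exact (hF.pos x h).le

theorem contDiff_gradient (hF : IsKickPotential F) : ContDiff ℝ 2 (gradient F) := by
  have h : gradient F = (InnerProductSpace.toDual ℝ (Space d)).symm ∘ fderiv ℝ F := rfl
  rw [h]
  exact (LinearIsometryEquiv.contDiff _).comp (hF.contDiff.fderiv_right (by norm_num))

theorem hasGradientAt (hF : IsKickPotential F) (x : Space d) :
    HasGradientAt F (gradient F x) x :=
  (hF.contDiff.differentiable (by norm_num) x).hasGradientAt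

theorem gradient_zero (hF : IsKickPotential F) : gradient F 0 = 0 := by
  have h : IsLocalMin F 0 := Eventually.of_forall fun x => by
    rw [hF.map_zero]; exact hF.nonneg x
  simp [gradient, h.fderiv_eq_zero]

theorem differentiable_gradient (hF : IsKickPotential F) : Differentiable ℝ (gradient F) :=
  hF.contDiff_gradient.differentiable (by norm_num)

theorem inner_hessian_comm (hF : IsKickPotential F) (v w : Space d) :
    inner ℝ (fderiv ℝ (gradient F) 0 v) w = inner ℝ v (fderiv ℝ (gradient F) 0 w) := by
  rw [real_inner_comm _ v, inner_fderiv_gradient, inner_fderiv_gradient]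
  exact (hF.contDiff.contDiffAt.isSymmSndFDerivAt (by simp; norm_num)).eq v w

theorem inner_hessian_pos (hF : IsKickPotential F) {v : Space d} (hv : v ≠ 0) :
    0 < inner ℝ (fderiv ℝ (gradient F) 0 v) v := by
  rw [inner_fderiv_gradient]
  exact hF.hessian_pos v hv

theorem exists_hessian_coercive (hF : IsKickPotential F) :
    ∃ c > 0, ∀ v, c * ‖v‖ ^ 2 ≤ inner ℝ (fderiv ℝ (gradient F) 0 v) v := by
  -- This form of the compactness argument allows an empty sphere, that is d = 0.
  obtain ⟨c, hc, h⟩ := (isCompact_sphere (0 : Space d) 1).exists_forall_le'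
    (f := fun v => inner ℝ (fderiv ℝ (gradient F) 0 v) v) (a := 0)
    (by fun_prop) (fun v hv => hF.inner_hessian_pos (by
      rintro rfl; simp at hv))
  refine ⟨c, hc, fun v => ?_⟩
  by_cases hv : v = 0
  · simp [hv]
  have h1 := h (‖v‖⁻¹ • v) (by simp [norm_smul, hv])
  simp only [map_smul, inner_smul_left, inner_smul_right, conj_trivial] at h1
  have h2 : 0 < ‖v‖ := norm_pos_iff.2 hv
  calc c * ‖v‖ ^ 2 ≤ _ := mul_le_mul_of_nonneg_right h1 (sq_nonneg _)
    _ = _ := by field_simp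

/-- Near the origin the gradient points outwards and the potential grows quadratically. -/
theorem exists_local_growth (hF : IsKickPotential F) :
    ∃ c > 0, ∃ ρ > 0, ∀ u : Space d, ‖u‖ < ρ →
      c * ‖u‖ ^ 2 ≤ inner ℝ (gradient F u) u ∧ c * ‖u‖ ^ 2 ≤ 2 * F u := by
  obtain ⟨c, hc, h⟩ := hF.exists_hessian_coercive
  have hd := (hF.differentiable_gradient 0).hasFDerivAt
  rw [hasFDerivAt_iff_isLittleO_nhds_zero, Asymptotics.isLittleO_iff] at hd
  obtain ⟨ρ, hρ, hball⟩ := Metric.eventually_nhds_iff_ball.1 (hd (half_pos hc))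
  have hgrad : ∀ u : Space d, ‖u‖ < ρ → c / 2 * ‖u‖ ^ 2 ≤ inner ℝ (gradient F u) u := by
    intro u hu
    have h1 := hball u (by simpa using hu)
    rw [zero_add, hF.gradient_zero, sub_zero] at h1
    have h2 := abs_real_inner_le_norm (gradient F u - fderiv ℝ (gradient F) 0 u) u
    rw [inner_sub_left] at h2
    have h3 := (abs_le.1 h2).1
    have h4 := h u
    nlinarith [norm_nonneg u]
  refine ⟨c / 2, half_pos hc, ρ, hρ, fun u hu => ⟨hgrad u hu, ?_⟩⟩
  -- The gradient bound makes φ nondecreasing along the ray, and φ 0 ≤ φ 1 is the growth estimate.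
  set φ : ℝ → ℝ := fun t => 2 * F (t • u) - c / 2 * ‖u‖ ^ 2 * t ^ 2
  have hφ : ∀ t, HasDerivAt φ (2 * inner ℝ (gradient F (t • u)) u -
      c / 2 * ‖u‖ ^ 2 * (2 * t)) t := by
    intro t
    have h1 : HasDerivAt (fun t : ℝ => t • u) u t := by
      simpa using (hasDerivAt_id t).smul_const u
    have h2 := (hF.hasGradientAt (t • u)).hasFDerivAt.comp_hasDerivAt t h1
    have h3 := (h2.const_mul 2).fun_sub ((hasDerivAt_pow 2 t).const_mul (c / 2 * ‖u‖ ^ 2))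
    simpa [φ] using h3
  have hmono : MonotoneOn φ (Icc 0 1) := by
    refine monotoneOn_of_deriv_nonneg (convex_Icc 0 1)
      (fun t _ => (hφ t).continuousAt.continuousWithinAt)
      (fun t _ => (hφ t).differentiableAt.differentiableWithinAt) fun t ht => ?_
    rw [interior_Icc] at ht
    rw [(hφ t).deriv]
    have h1 := hgrad (t • u) (by
      rw [norm_smul, Real.norm_eq_abs, abs_of_pos ht.1]
      nlinarith [norm_nonneg u, ht.2])
    rw [norm_smul, Real.norm_eq_abs, abs_of_pos ht.1, inner_smul_right] at h1
    have h2 : c / 2 * ‖u‖ ^ 2 * t ≤ inner ℝ (gradient F (t • u)) u := by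
      refine le_of_mul_le_mul_left ?_ ht.1
      linarith
    linarith
  have := hmono (left_mem_Icc.2 zero_le_one) (right_mem_Icc.2 zero_le_one) zero_le_one
  simp only [φ, zero_smul, hF.map_zero, one_smul] at this
  linarith

/-- The potential dominates the squared distance to the lattice. -/
theorem exists_growth (hF : IsKickPotential F) :
    ∃ c > 0, ∀ y : Space d, c * ‖(y : Torus d)‖ ^ 2 ≤ F y := by
  obtain ⟨c, hc, ρ, hρ, h⟩ := hF.exists_local_growth
  have hK : IsCompact (Metric.closedBall (0 : Space d) √d ∩ {x | ρ ≤ ‖(x : Torus d)‖}) :=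
    (isCompact_closedBall _ _).inter_right
      (isClosed_le continuous_const (continuous_norm.comp continuous_quot_mk))
  obtain ⟨m, hm, hmF⟩ := hK.exists_forall_le' (f := F) (a := 0)
    hF.contDiff.continuous.continuousOn
    (fun x hx => hF.pos x (not_mem_lattice_of_norm_pos (hρ.trans_le hx.2)))
  -- Near the lattice the local growth applies. Elsewhere F ≥ m, while the squared torus norm is at
  -- most d; the extra 1 keeps the denominator positive when d = 0.
  refine ⟨min (c / 2) (m / (d + 1)), by positivity, fun y => ?_⟩
  by_cases hy : ‖(y : Torus d)‖ < ρ
  · obtain ⟨x, hx, hxρ⟩ := exists_lift_of_norm_lt hy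
    have h1 := (h x hxρ).2
    rw [← hF.periodic.eq_of_coe_eq hx, ← hx]
    calc _ ≤ c / 2 * ‖x‖ ^ 2 := mul_le_mul (min_le_left _ _)
          (pow_le_pow_left₀ (norm_nonneg _) (norm_torus_le x) 2) (by positivity) (by positivity)
      _ ≤ _ := by linarith
  · obtain ⟨x, hx, hxd⟩ := exists_coe_eq_norm_le y
    rw [← hF.periodic.eq_of_coe_eq hx, ← hx]
    have h1 : m ≤ F x := hmF x ⟨by simpa using hxd, (not_lt.1 hy).trans_eq (by rw [hx])⟩
    have h2 : ‖(x : Torus d)‖ ^ 2 ≤ d + 1 := by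
      have h3 := pow_le_pow_left₀ (norm_nonneg _) ((norm_torus_le x).trans hxd) 2
      rw [Real.sq_sqrt (by positivity)] at h3
      linarith
    calc _ ≤ m / (d + 1) * (d + 1) := mul_le_mul (min_le_right _ _) h2 (by positivity)
          (by positivity)
      _ = m := by field_simp
      _ ≤ _ := h1

end IsKickPotential

theorem hasFDerivAt_twistMap (hF : IsKickPotential F) :
    HasFDerivAt (twistMap F) (linearTwist (fderiv ℝ (gradient F) 0)) (0, 0) := by
  have hg : HasFDerivAt (gradient F) (fderiv ℝ (gradient F) 0) ((0, 0) : Space d × Space d).1 :=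
    (hF.differentiable_gradient 0).hasFDerivAt
  have h1 := (hasFDerivAt_snd (𝕜 := ℝ) (p := ((0, 0) : Space d × Space d))).add
    (hg.comp ((0, 0) : Space d × Space d) hasFDerivAt_fst)
  exact (hasFDerivAt_fst.add h1).prodMk h1

end Potential

/-! ### Construction of the unstable chart -/

section UnstableChart

variable {d : ℕ} {F : Space d → ℝ}

/-- `v` is the sequence of positions of a backward orbit of the twist map. -/
def IsBackwardOrbit (F : Space d → ℝ) (v : ℕ → Space d) : Prop :=
  ∀ n : ℕ, v (n + 2) = (2 : ℝ) • v (n + 1) - v n + gradient F (v (n + 1))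

/-- `u` parametrizes the small backward orbits by their initial position, the unstable manifold is
the graph of `x ↦ x - u x 1`, and `S` is its tangent map at the origin. -/
structure IsUnstableChart (F : Space d → ℝ) (ρ C : ℝ) (u : Space d → ConvSeq (Space d))
    (S : Space d →L[ℝ] Space d) : Prop where
  pos : 0 < ρ
  le : ρ ≤ 1 / 8
  contDiffOn : ContDiffOn ℝ 2 u (Metric.ball 0 ρ)
  map_zero : u 0 = 0
  hasFDerivAt : HasFDerivAt (fun x => x - u x ((1 : ℕ) : OnePoint ℕ)) S 0
  initial : ∀ x, ‖x‖ < ρ → u x ((0 : ℕ) : OnePoint ℕ) = x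
  limit : ∀ x, ‖x‖ < ρ → u x OnePoint.infty = 0
  orbit : ∀ x, ‖x‖ < ρ → IsBackwardOrbit F fun n => u x n
  unique : ∀ v : ConvSeq (Space d), ‖v‖ < ρ → IsBackwardOrbit F (fun n => v n) →
    v = u (v ((0 : ℕ) : OnePoint ℕ))
  bound : ∀ i : ℕ, i ≤ 2 → ∀ x, ‖x‖ < ρ →
    ‖iteratedFDeriv ℝ i (fun x => x - u x ((1 : ℕ) : OnePoint ℕ)) x‖ ≤ C

theorem eventually_norm_iteratedFDeriv_le {E G : Type*} [NormedAddCommGroup E] [NormedSpace ℝ E]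
    [NormedAddCommGroup G] [NormedSpace ℝ G] {f : E → G} {x : E} {n : ℕ} (hf : ContDiffAt ℝ n f x) :
    ∃ C : ℝ, ∀ᶠ y in 𝓝 x, ∀ i : ℕ, i ≤ n → ‖iteratedFDeriv ℝ i f y‖ ≤ C := by
  have hc : ∀ i : ℕ, i ≤ n → ContinuousAt (iteratedFDeriv ℝ i f) x := fun i hi =>
    (hf.iteratedFDeriv_right (m := 0) (i := i) (by simpa using hi)).continuousAt
  refine ⟨∑ i ∈ Finset.range (n + 1), (‖iteratedFDeriv ℝ i f x‖ + 1), ?_⟩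
  have h : ∀ᶠ y in 𝓝 x, ∀ i ∈ Finset.range (n + 1),
      ‖iteratedFDeriv ℝ i f y‖ < ‖iteratedFDeriv ℝ i f x‖ + 1 :=
    (Filter.eventually_all_finset _).2 fun i hi =>
      (hc i (Finset.mem_range_succ_iff.1 hi)).norm.eventually_lt_const (by simp)
  filter_upwards [h] with y hy i hi
  have hi' := Finset.mem_range_succ_iff.2 hi
  exact (hy i hi').le.trans (Finset.single_le_sum
    (f := fun i => ‖iteratedFDeriv ℝ i f x‖ + 1) (fun j _ => by positivity) hi')

theorem exists_isUnstableChart (hF : IsKickPotential F) :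
    IsHyperbolic (fderiv ℝ (twistMap F) (0, 0)) ∧
    ∃ (ρ C : ℝ) (u : Space d → ConvSeq (Space d)) (S : Space d →L[ℝ] Space d),
      IsUnstableChart F ρ C u S ∧ (∀ x y, inner ℝ (S x) y = inner ℝ x (S y)) ∧
      ∀ v, v ≠ 0 → 0 < inner ℝ (S v) v := by
  obtain ⟨L, G, B, M, q, hq0, hq1, hL, hB, hLG, hGL, hsum, hBA, hAB, hMG, hGM, hS, hSpos⟩ :=
    exists_spectral_root (fderiv ℝ (gradient F) 0) hF.inner_hessian_comm
      fun v hv => hF.inner_hessian_pos hv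
  refine ⟨?_, ?_⟩
  · rw [(hasFDerivAt_twistMap hF).fderiv]
    exact isHyperbolic_linearTwist hq0 hq1 hL hLG hGL hsum hMG hGM
  obtain ⟨u, hu0, huc, hud, huo, huu⟩ := exists_backwardOrbits hF.contDiff_gradient
    hF.gradient_zero hq0 hq1 hL hB hLG hsum hBA hAB
  obtain ⟨c, hc, ρ₁, hρ₁, hgrow⟩ := hF.exists_local_growth
  have hw2 : ContDiffAt ℝ (2 : ℕ) (fun x => x - u x ((1 : ℕ) : OnePoint ℕ)) 0 :=
    contDiffAt_id.sub ((termCLM (Space d) 1).contDiff.contDiffAt.comp 0 huc)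
  obtain ⟨C, hC⟩ := eventually_norm_iteratedFDeriv_le hw2
  have hsmall : ∀ᶠ x in 𝓝 (0 : Space d), ‖u x‖ < ρ₁ := by
    have h1 := huc.continuousAt.norm
    refine h1.eventually_lt_const ?_
    simpa [hu0] using hρ₁
  obtain ⟨ρ₂, hρ₂, h2⟩ := Metric.eventually_nhds_iff_ball.1
    ((huc.eventually (by simp)).and (huo.and (hC.and hsmall)))
  obtain ⟨ρ₃, hρ₃, h3⟩ := Metric.eventually_nhds_iff_ball.1 huu
  have hball : ∀ x : Space d, ‖x‖ < min (min ρ₂ ρ₃) (1 / 8) → x ∈ Metric.ball 0 ρ₂ := fun x hx =>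
    mem_ball_zero_iff.2 (hx.trans_le ((min_le_left _ _).trans (min_le_left _ _)))
  -- The bound 1/8 keeps positions and their successors where the torus norm equals the Euclidean
  -- one.
  refine ⟨min (min ρ₂ ρ₃) (1 / 8), C, u, ContinuousLinearMap.id ℝ _ - L,
    { pos := by positivity
      le := min_le_right _ _
      contDiffOn := fun x hx => (h2 x (hball x (mem_ball_zero_iff.1 hx))).1.contDiffWithinAt
      map_zero := hu0
      hasFDerivAt := (hasFDerivAt_id _).sub hud
      initial := fun x hx => (h2 x (hball x hx)).2.1.1
      limit := fun x hx => ?_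
      orbit := fun x hx => (h2 x (hball x hx)).2.1.2
      unique := fun v hv hvo => h3 v (mem_ball_zero_iff.2
        (hv.trans_le ((min_le_left _ _).trans (min_le_right _ _)))) hvo
      bound := fun i hi x hx => (h2 x (hball x hx)).2.2.1 i hi }, hS, hSpos⟩
  obtain ⟨-, ⟨-, ho⟩, -, hs⟩ := h2 x (hball x hx)
  have ht := tendsto_convSeq (u x)
  have ht1 := (tendsto_add_atTop_iff_nat 1).2 ht
  have ht2 := (tendsto_add_atTop_iff_nat 2).2 ht
  -- The limit of an orbit is a critical point of F by passing to the limit in the recurrence; local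
  -- growth makes 0 the only critical point nearby.
  have hlim := tendsto_nhds_unique ht2 ((((ht1.const_smul (2 : ℝ)).sub ht).add
    ((hF.contDiff_gradient.continuous.tendsto _).comp ht1)).congr fun n => (ho n).symm)
  have hg0 : gradient F (u x OnePoint.infty) = 0 := by
    rw [two_smul, add_sub_cancel_right, left_eq_add] at hlim
    exact hlim
  have h4 := (hgrow (u x OnePoint.infty) (((u x).norm_coe_le_norm _).trans_lt hs)).1
  rw [hg0, inner_zero_left] at h4
  have h5 : ‖u x OnePoint.infty‖ ^ 2 ≤ 0 := by
    by_contra! h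
    nlinarith
  simpa using h5

end UnstableChart

/-! ### The local unstable manifold as a graph -/

section BackwardIterates

variable {d : ℕ} {F : Space d → ℝ}

theorem torusTwistMap_symm_proj (hF : IsPeriodic F) (z : Space d × Space d) :
    (torusTwistMap F hF).symm (proj z) = proj ((twistMap F).symm z) := by
  rw [Equiv.symm_apply_eq, torusTwistMap_proj, Equiv.apply_symm_apply]

theorem torusTwistMap_symm_iterate_proj (hF : IsPeriodic F) (n : ℕ) (z : Space d × Space d) :
    ((torusTwistMap F hF).symm : _ → _)^[n] (proj z) =
      proj (((twistMap F).symm : _ → _)^[n] z) :=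
  ((Function.Semiconj.iterate_right
    (show Function.Semiconj proj (twistMap F).symm (torusTwistMap F hF).symm from
      fun z => (torusTwistMap_symm_proj hF z).symm) n) z).symm

theorem twistMap_symm_iterate {v : ℕ → Space d} (hv : IsBackwardOrbit F v) (n : ℕ) :
    ((twistMap F).symm : _ → _)^[n] (v 0, v 0 - v 1) = (v n, v n - v (n + 1)) := by
  induction n with
  | zero => rfl
  | succ n ih =>
    rw [Function.iterate_succ_apply', ih]
    change (v n - (v n - v (n + 1)), v n - v (n + 1) -
      gradient F (v n - (v n - v (n + 1)))) = _
    rw [sub_sub_cancel, hv n, two_smul]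
    congr 1
    abel

theorem isBackwardOrbit_iterate (F : Space d → ℝ) (z : Space d × Space d) :
    IsBackwardOrbit F (fun n => (((twistMap F).symm : _ → _)^[n] z).1) ∧
      ∀ n, (((twistMap F).symm : _ → _)^[n] z).2 =
        (((twistMap F).symm : _ → _)^[n] z).1 - (((twistMap F).symm : _ → _)^[n + 1] z).1 := by
  have h1 : ∀ n, (((twistMap F).symm : _ → _)^[n + 1] z).1 =
      (((twistMap F).symm : _ → _)^[n] z).1 - (((twistMap F).symm : _ → _)^[n] z).2 := fun n => by
    rw [Function.iterate_succ_apply']; rfl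
  have h2 : ∀ n, (((twistMap F).symm : _ → _)^[n + 1] z).2 =
      (((twistMap F).symm : _ → _)^[n] z).2 -
        gradient F ((((twistMap F).symm : _ → _)^[n + 1] z).1) := fun n => by
    rw [h1, Function.iterate_succ_apply']; rfl
  refine ⟨fun n => ?_, fun n => by rw [h1]; abel⟩
  simp only
  rw [h1 (n + 1), h2, two_smul]
  nth_rewrite 3 [h1 n]
  abel

theorem dist_proj_lt_iff {z : Space d × Space d} {ε : ℝ} :
    dist (proj z) (0, 0) < ε ↔ ‖(z.1 : Torus d)‖ < ε ∧ ‖z.2‖ < ε := by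
  rw [Prod.dist_eq, max_lt_iff, dist_zero_right, dist_zero_right]
  rfl

/-- The set of initial positions of the local unstable manifold. -/
def unstableDomain (ρ ε : ℝ) (u : Space d → ConvSeq (Space d)) : Set (Space d) :=
  Metric.ball 0 ρ ∩ {x | ‖u x‖ < ε ∧ ‖u x - shift (Space d) (u x)‖ < ε}

variable {ρ C : ℝ} {u : Space d → ConvSeq (Space d)} {S : Space d →L[ℝ] Space d}

theorem IsUnstableChart.isOpen_domain (h : IsUnstableChart F ρ C u S) (ε : ℝ) :
    IsOpen (unstableDomain ρ ε u) := by
  have hc : ContinuousOn (fun x => (‖u x‖, ‖u x - shift (Space d) (u x)‖)) (Metric.ball 0 ρ) := by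
    have := h.contDiffOn.continuousOn
    exact this.norm.prodMk (this.sub ((shift (Space d)).continuous.comp_continuousOn this)).norm
  exact hc.isOpen_inter_preimage Metric.isOpen_ball (isOpen_Iio.prod (isOpen_Iio (a := ε)))

theorem IsUnstableChart.zero_mem_domain (h : IsUnstableChart F ρ C u S) {ε : ℝ} (hε : 0 < ε) :
    0 ∈ unstableDomain ρ ε u :=
  ⟨by simpa using h.pos, by simpa [h.map_zero] using hε⟩

theorem IsUnstableChart.norm_lt_of_mem_domain (h : IsUnstableChart F ρ C u S) {ε : ℝ} {x : Space d}
    (hx : x ∈ unstableDomain ρ ε u) : ‖x‖ < ε := by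
  have h1 := (u x).norm_coe_le_norm ((0 : ℕ) : OnePoint ℕ)
  rw [h.initial x (mem_ball_zero_iff.1 hx.1)] at h1
  exact h1.trans_lt hx.2.1

/-- A convergent backward orbit that stays close to the origin comes from the chart. -/
theorem IsUnstableChart.mem_domain_of_orbit (h : IsUnstableChart F ρ C u S) {ε : ℝ} (hε : ε ≤ ρ)
    {v : ℕ → Space d} (hv : IsBackwardOrbit F v) (h1 : ∀ n, ‖v n‖ < ε)
    (h2 : ∀ n, ‖v n - v (n + 1)‖ < ε) (h3 : Tendsto v atTop (𝓝 0)) :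
    v 0 ∈ unstableDomain ρ ε u ∧ ∀ n : ℕ, u (v 0) n = v n := by
  have hε0 : 0 < ε := (norm_nonneg _).trans_lt (h1 0)
  set V : ConvSeq (Space d) := OnePoint.continuousMapMkNat v 0 h3
  -- Strict pointwise bounds give a strict bound on the supremum because ℕ ∪ {∞} is compact and the
  -- bound also holds at ∞.
  have hV : ‖V‖ < ε := by
    refine (ContinuousMap.norm_lt_iff _ hε0).2 fun k => ?_
    induction k using OnePoint.rec with
    | infty => exact (norm_zero (E := Space d)).trans_lt hε0
    | coe n => exact h1 n
  have hV' : ‖V - shift (Space d) V‖ < ε := by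
    refine (ContinuousMap.norm_lt_iff _ hε0).2 fun k => ?_
    induction k using OnePoint.rec with
    | infty => rw [ContinuousMap.sub_apply, shift_apply_infty, sub_self, norm_zero]; exact hε0
    | coe n => exact h2 n
  have hu : V = u (v 0) := h.unique V (hV.trans_le hε) hv
  refine ⟨⟨mem_ball_zero_iff.2 ((h1 0).trans_le hε), ?_⟩, fun n => by rw [← hu]; rfl⟩
  exact ⟨hu ▸ hV, hu ▸ hV'⟩

/-- Steps shorter than ε cannot carry the lifted orbit from the neighbourhood of 0 to that of
another lattice point. -/
theorem norm_iterate_lt {ε : ℝ} (hε : ε ≤ 1 / 8) {v : ℕ → Space d} (h0 : ‖v 0‖ < ε)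
    (h1 : ∀ n, ‖(v n : Torus d)‖ < ε) (h2 : ∀ n, ‖v n - v (n + 1)‖ < ε) (n : ℕ) : ‖v n‖ < ε := by
  induction n with
  | zero => exact h0
  | succ n ih =>
    have h3 : ‖v (n + 1)‖ ≤ 1 / 2 := by
      have := norm_sub_le (v n) (v n - v (n + 1))
      rw [sub_sub_cancel] at this
      linarith [h2 n]
    rw [← norm_torus_eq h3]
    exact h1 (n + 1)

theorem tendsto_zero_of_torus {v : ℕ → Space d} (h1 : ∀ n, ‖v n‖ ≤ 1 / 2)
    (h : Tendsto (fun n => ‖(v n : Torus d)‖) atTop (𝓝 0)) : Tendsto v atTop (𝓝 0) := by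
  rw [tendsto_zero_iff_norm_tendsto_zero]
  exact h.congr fun n => norm_torus_eq (h1 n)

/-- The local unstable manifold is the graph over the domain of the chart. -/
theorem IsUnstableChart.localUnstable_eq (h : IsUnstableChart F ρ C u S) (hF : IsPeriodic F)
    {ε : ℝ} (hε : ε ≤ ρ) :
    localUnstable (torusTwistMap F hF) (0, 0) ε =
      proj '' ((fun x => (x, x - u x ((1 : ℕ) : OnePoint ℕ))) '' unstableDomain ρ ε u) := by
  ext z
  constructor
  · rintro ⟨h1, h2⟩
    obtain ⟨ξ, p⟩ := z
    have h10 : ‖ξ‖ < ε := by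
      have := h1 0
      rw [Function.iterate_zero_apply, Prod.dist_eq, max_lt_iff, dist_zero_right] at this
      exact this.1
    obtain ⟨x, rfl, hx⟩ := exists_lift_of_norm_lt h10
    set z : Space d × Space d := (x, p)
    set v : ℕ → Space d := fun n => (((twistMap F).symm : _ → _)^[n] z).1
    obtain ⟨hv, hv2⟩ := isBackwardOrbit_iterate F z
    have hiter : ∀ n, ((torusTwistMap F hF).symm : _ → _)^[n] ((x : Torus d), p) =
        proj (v n, v n - v (n + 1)) := fun n => by
      rw [show (((x : Torus d), p) : Torus d × Space d) = proj z from rfl,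
        torusTwistMap_symm_iterate_proj]
      exact congrArg proj (Prod.ext rfl (hv2 n))
    simp only [hiter, dist_proj_lt_iff] at h1 h2
    have hle : ∀ n, ‖v n‖ < ε := norm_iterate_lt (hε.trans h.le) hx (fun n => (h1 n).1)
      fun n => (h1 n).2
    have hlim : Tendsto v atTop (𝓝 0) :=
      tendsto_zero_of_torus (fun n => (hle n).le.trans (by linarith [h.le])) (by
        have := ((continuous_fst.tendsto _).comp h2).norm
        rwa [norm_zero] at this)
    obtain ⟨hmem, hu⟩ := h.mem_domain_of_orbit hε hv hle (fun n => (h1 n).2) hlim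
    refine ⟨_, ⟨x, hmem, rfl⟩, ?_⟩
    have hp : p = x - v 1 := hv2 0
    change ((x : Torus d), x - u (v 0) _) = _
    rw [hu 1, hp]
  · rintro ⟨_, ⟨x, hx, rfl⟩, rfl⟩
    have hxρ : ‖x‖ < ρ := mem_ball_zero_iff.1 hx.1
    have horb := h.orbit x hxρ
    have hiter : ∀ n, ((torusTwistMap F hF).symm : _ → _)^[n]
        (proj (x, x - u x ((1 : ℕ) : OnePoint ℕ))) = proj (u x n, u x n - u x (n + 1 : ℕ)) :=
      fun n => by
        have := twistMap_symm_iterate horb n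
        rw [h.initial x hxρ] at this
        rw [torusTwistMap_symm_iterate_proj, this]
    refine ⟨fun n => ?_, ?_⟩
    · rw [hiter, dist_proj_lt_iff]
      exact ⟨(norm_torus_le _).trans_lt (((u x).norm_coe_le_norm _).trans_lt hx.2.1),
        (ContinuousMap.norm_coe_le_norm (u x - shift (Space d) (u x)) n).trans_lt hx.2.2⟩
    · simp only [hiter]
      have ht := tendsto_convSeq (u x)
      rw [h.limit x hxρ] at ht
      have ht2 := ht.sub ((tendsto_add_atTop_iff_nat 1).2 ht)
      rw [sub_zero] at ht2
      exact ((continuous_quot_mk.tendsto _).comp ht).prodMk_nhds ht2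

end BackwardIterates

/-! ### The tangent plane of a graph -/

section TangentPlane

variable {E : Type*} [NormedAddCommGroup E] [NormedSpace ℝ E]

/-- The function z.2 - w z.1 vanishes on the graph, so its derivative annihilates the cone;
conversely x ↦ (x, w x) pushes forward the full tangent cone of V. -/
theorem tangentConeAt_graph {V : Set E} {w : E → E} {S : E →L[ℝ] E} (hV : V ∈ 𝓝 0)
    (hw : HasFDerivAt w S 0) (hw0 : w 0 = 0) :
    tangentConeAt ℝ ((fun x => (x, w x)) '' V) ((0, 0) : E × E) = range fun h => (h, S h) := by
  have hg : HasFDerivAt (fun x => (x, w x)) ((ContinuousLinearMap.id ℝ E).prod S) 0 :=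
    (hasFDerivAt_id _).prodMk hw
  refine Subset.antisymm ?_ ?_
  · rintro ⟨a, b⟩ hab
    refine ⟨a, ?_⟩
    have h1 : HasFDerivAt (fun z : E × E => z.2 - w z.1) (ContinuousLinearMap.snd ℝ E E -
        S.comp (ContinuousLinearMap.fst ℝ E E)) (0, 0) :=
      hasFDerivAt_snd.sub (HasFDerivAt.comp ((0, 0) : E × E) hw hasFDerivAt_fst)
    have h2 := h1.hasFDerivWithinAt.mapsTo_tangent_cone hab
    have h3 : (fun z : E × E => z.2 - w z.1) '' ((fun x => (x, w x)) '' V) ⊆ {0} := by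
      rintro _ ⟨_, ⟨x, -, rfl⟩, rfl⟩
      simp
    have h4 := tangentConeAt_subset_zero (𝕜 := ℝ) (s := ({0} : Set E)) (x := 0)
      (fun hacc => by
        have h5 := accPt_iff_frequently.1 hacc
        obtain ⟨y, hy1, hy2⟩ := h5.exists
        exact hy1 hy2) (by
        have := tangentConeAt_mono h3 h2
        simpa [hw0] using this)
    have h5 : b - S a = 0 := h4
    simp [sub_eq_zero.1 h5]
  · have h1 := hg.hasFDerivWithinAt (s := V) |>.mapsTo_tangent_cone
    rw [tangentConeAt_of_mem_nhds hV] at h1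
    rintro _ ⟨a, rfl⟩
    have := h1 (mem_univ a)
    rwa [hw0] at this

theorem exists_posDef_matrix {d : ℕ} (S : Space d →L[ℝ] Space d)
    (hS : ∀ x y, inner ℝ (S x) y = inner ℝ x (S y)) (hpos : ∀ v, v ≠ 0 → 0 < inner ℝ (S v) v) :
    ∃ M : Matrix (Fin d) (Fin d) ℝ, M.PosDef ∧ Matrix.toEuclideanCLM (𝕜 := ℝ) M = S := by
  refine ⟨(Matrix.toEuclideanCLM (𝕜 := ℝ) (n := Fin d)).symm S, ?_, by simp⟩
  set M := (Matrix.toEuclideanCLM (𝕜 := ℝ) (n := Fin d)).symm S with hM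
  have hMS : Matrix.toEuclideanCLM (𝕜 := ℝ) M = S := by simp [hM]
  refine Matrix.PosDef.of_dotProduct_mulVec_pos ?_ fun x hx => ?_
  · have h1 : star S = S := by
      rw [ContinuousLinearMap.star_eq_adjoint]
      exact (ContinuousLinearMap.eq_adjoint_iff S S).2 hS |>.symm
    rw [Matrix.IsHermitian, ← Matrix.star_eq_conjTranspose]
    refine (Matrix.toEuclideanCLM (𝕜 := ℝ) (n := Fin d)).injective ?_
    exact ((Matrix.toEuclideanCLM (𝕜 := ℝ) (n := Fin d)).map_star' M).trans 
      (((congrArg star hMS).trans h1).trans hMS.symm)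
  · have h1 := hpos (WithLp.toLp 2 x) (by simpa using hx)
    rw [← hMS, real_inner_comm, EuclideanSpace.inner_eq_star_dotProduct] at h1
    rw [dotProduct_comm]
    exact h1

end TangentPlane

/-! ### Differentiability at touching points -/

section Touching

variable {E : Type*} [NormedAddCommGroup E] [NormedSpace ℝ E]

theorem hasFDerivAt_eq_of_le {f φ : E → ℝ} {f' φ' : E →L[ℝ] ℝ} {x : E} (hf : HasFDerivAt f f' x)
    (hφ : HasFDerivAt φ φ' x) (hle : ∀ y, f y ≤ φ y) (heq : f x = φ x) : f' = φ' := by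
  have hmin : IsLocalMin (fun y => φ y - f y) x :=
    Eventually.of_forall fun y => by simp only [heq, sub_self, sub_nonneg, hle]
  exact (sub_eq_zero.1 (hmin.hasFDerivAt_eq_zero (hφ.sub hf))).symm

/-- A function squeezed between two differentiable functions that touch is differentiable. -/
theorem hasFDerivAt_of_squeeze {f φ χ : E → ℝ} {φ' χ' : E →L[ℝ] ℝ} {x : E}
    (hφ : HasFDerivAt φ φ' x) (hχ : HasFDerivAt χ χ' x) (h1 : ∀ y, φ y ≤ f y)
    (h2 : ∀ y, f y ≤ χ y) (e1 : φ x = f x) (e2 : f x = χ x) : HasFDerivAt f φ' x := by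
  have heq : φ' = χ' := hasFDerivAt_eq_of_le hφ hχ (fun y => (h1 y).trans (h2 y)) (e1.trans e2)
  have hd : HasFDerivAt (fun y => χ y - φ y) (0 : E →L[ℝ] ℝ) x := by
    simpa [heq] using hχ.fun_sub hφ
  have hf : HasFDerivAt (fun y => f y - φ y) (0 : E →L[ℝ] ℝ) x := by
    refine .of_isLittleO (Asymptotics.IsBigO.trans_isLittleO (.of_bound 1 ?_) hd.isLittleO)
    refine Eventually.of_forall fun y => ?_
    have h3 := h1 y
    have h4 := h2 y
    simp only [e1, ← e2, sub_self, sub_zero, zero_apply, Real.norm_eq_abs, one_mul]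
    rw [abs_of_nonneg (by linarith), abs_of_nonneg (by linarith)]
    linarith
  simpa using hf.fun_add hφ

end Touching

/-! ### Minimizers of the stationary solution and their orbits -/

section Stationary

variable {d : ℕ} {F ψ : Space d → ℝ}

theorem hasGradientAt_half_norm_sub_sq (a x : Space d) :
    HasGradientAt (fun y : Space d => ‖y - a‖ ^ 2 / 2) (x - a) x := by
  rw [hasGradientAt_iff_hasFDerivAt]
  have h := (((hasFDerivAt_id (𝕜 := ℝ) x).sub_const a).norm_sq).mul_const (1 / 2 : ℝ)
  refine (h.congr_fderiv ?_).congr_of_eventuallyEq (Eventually.of_forall fun y => ?_)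
  · ext v
    simp
  · simp [div_eq_mul_inv]

namespace IsStationarySolution

theorem le_add (hψ : IsStationarySolution F ψ) (x z : Space d) :
    ψ x ≤ ψ z + genFun F z x := (hψ.fixed x).2 ⟨z, rfl⟩

theorem mem_minimizers_iff (hψ : IsStationarySolution F ψ) {x y : Space d} :
    y ∈ minimizers F ψ x ↔ ψ x = ψ y + genFun F y x := by
  constructor
  · intro h
    obtain ⟨z, hz⟩ := (hψ.fixed x).1
    exact le_antisymm (hψ.le_add x y) ((h z).trans_eq hz)
  · intro h z
    rw [← h]
    exact hψ.le_add x z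

theorem exists_mem_minimizers (hψ : IsStationarySolution F ψ) (x : Space d) :
    ∃ y, y ∈ minimizers F ψ x := by
  obtain ⟨z, hz⟩ := (hψ.fixed x).1
  exact ⟨z, hψ.mem_minimizers_iff.2 hz.symm⟩

/-- At a global minimum x₀ of ψ, a minimizer y must satisfy F(y) = 0, so y is a lattice point, ψ(y)
= 0 and ψ(x₀) ≥ 0. -/
theorem nonneg (hF : IsKickPotential F) (hψ : IsStationarySolution F ψ) (x : Space d) :
    0 ≤ ψ x := by
  obtain ⟨x₀, -, hx₀⟩ := (isCompact_closedBall (0 : Space d) √d).exists_isMinOn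
    ⟨0, by simp⟩ hψ.continuous.continuousOn
  have hmin : ∀ y, ψ x₀ ≤ ψ y := fun y => by
    obtain ⟨z, hz, hzd⟩ := exists_coe_eq_norm_le y
    rw [← hψ.periodic.eq_of_coe_eq hz]
    exact hx₀ (by simpa using hzd)
  obtain ⟨y, hy⟩ := hψ.exists_mem_minimizers x₀
  have h1 := hψ.mem_minimizers_iff.1 hy
  have h2 := hmin y
  have h3 := hF.nonneg y
  rw [genFun] at h1
  have h4 := sq_nonneg ‖x₀ - y‖
  have h5 : F y = 0 := by linarith
  have h6 : y ∈ intLattice d := by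
    by_contra h
    exact (hF.pos y h).ne' h5
  have h7 := hψ.periodic 0 y h6
  rw [zero_add, hψ.map_zero] at h7
  linarith [hmin x]

theorem kinetic_le (hF : IsKickPotential F) (hψ : IsStationarySolution F ψ) {x y : Space d}
    (hy : y ∈ minimizers F ψ x) : ‖x - y‖ ^ 2 ≤ 2 * ψ x := by
  have h1 := hψ.mem_minimizers_iff.1 hy
  rw [genFun] at h1
  linarith [hF.nonneg y, hψ.nonneg hF y]

theorem le_half_norm_sq (hF : IsKickPotential F) (hψ : IsStationarySolution F ψ) (x : Space d) :
    ψ x ≤ ‖x‖ ^ 2 / 2 := by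
  have := hψ.le_add x 0
  rwa [genFun, hψ.map_zero, hF.map_zero, sub_zero, zero_add, add_zero] at this

theorem two_mul_le_norm_torus_sq (hF : IsKickPotential F) (hψ : IsStationarySolution F ψ)
    (x : Space d) : 2 * ψ x ≤ ‖(x : Torus d)‖ ^ 2 := by
  refine (Real.sqrt_le_left (norm_nonneg _)).1 (QuotientAddGroup.le_norm_iff.2 fun m hm => ?_)
  rw [← hψ.periodic.eq_of_coe_eq hm, Real.sqrt_le_left (norm_nonneg _)]
  linarith [hψ.le_half_norm_sq hF m]

theorem le_dim (hF : IsKickPotential F) (hψ : IsStationarySolution F ψ) (x : Space d) :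
    ψ x ≤ d / 2 := by
  obtain ⟨y, hy, hyd⟩ := exists_coe_eq_norm_le x
  rw [← hψ.periodic.eq_of_coe_eq hy]
  have h := pow_le_pow_left₀ (norm_nonneg _) hyd 2
  rw [Real.sq_sqrt (by positivity)] at h
  linarith [hψ.le_half_norm_sq hF y]

/-- Here ψ(x) ≥ ψ(y) + F(y), and F(y) ≥ c|y|² ≥ 2cψ(y). -/
theorem contraction (hF : IsKickPotential F) (hψ : IsStationarySolution F ψ) {c : ℝ} (hc : 0 < c)
    (hgrow : ∀ y : Space d, c * ‖(y : Torus d)‖ ^ 2 ≤ F y) {x y : Space d}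
    (hy : y ∈ minimizers F ψ x) : ψ y ≤ (1 + 2 * c)⁻¹ * ψ x := by
  have h1 := hψ.mem_minimizers_iff.1 hy
  rw [genFun] at h1
  have h2 := hgrow y
  have h3 := hψ.two_mul_le_norm_torus_sq hF y
  have h4 := sq_nonneg ‖x - y‖
  rw [inv_mul_eq_div, le_div_iff₀ (by positivity)]
  nlinarith

/-- Going from the lattice to x costs either kinetic energy |x - y|²/2 or potential energy F(y); the
constants come from (a + b)² ≤ 2a² + 2b². -/
theorem lower_bound (hF : IsKickPotential F) (hψ : IsStationarySolution F ψ) {c : ℝ} (hc : 0 < c)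
    (hgrow : ∀ y : Space d, c * ‖(y : Torus d)‖ ^ 2 ≤ F y) (x : Space d) :
    min (1 / 4) (c / 2) * ‖(x : Torus d)‖ ^ 2 ≤ ψ x := by
  obtain ⟨y, hy⟩ := hψ.exists_mem_minimizers x
  have h1 := hψ.mem_minimizers_iff.1 hy
  rw [genFun] at h1
  have h2 := hgrow y
  have h3 : ‖(x : Torus d)‖ ≤ ‖x - y‖ + ‖(y : Torus d)‖ := by
    have h4 := norm_add_le ((x - y : Space d) : Torus d) (y : Torus d)
    rw [← QuotientAddGroup.mk_add, sub_add_cancel] at h4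
    linarith [norm_torus_le (x - y)]
  have h5 : ‖(x : Torus d)‖ ^ 2 ≤ 2 * ‖x - y‖ ^ 2 + 2 * ‖(y : Torus d)‖ ^ 2 := by
    have := pow_le_pow_left₀ (norm_nonneg _) h3 2
    nlinarith [sq_nonneg (‖x - y‖ - ‖(y : Torus d)‖)]
  have h6 := hψ.nonneg hF y
  have h7 : min (1 / 4) (c / 2) * ‖(x : Torus d)‖ ^ 2 ≤
      1 / 4 * (2 * ‖x - y‖ ^ 2) + c / 2 * (2 * ‖(y : Torus d)‖ ^ 2) := by
    calc _ ≤ min (1 / 4) (c / 2) * (2 * ‖x - y‖ ^ 2 + 2 * ‖(y : Torus d)‖ ^ 2) :=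
          mul_le_mul_of_nonneg_left h5 (by positivity)
      _ ≤ _ := by
        rw [mul_add]
        exact add_le_add (mul_le_mul_of_nonneg_right (min_le_left _ _) (by positivity))
          (mul_le_mul_of_nonneg_right (min_le_right _ _) (by positivity))
  linarith

/-- The semiconcavity inequality. -/
theorem le_add_inner (hψ : IsStationarySolution F ψ) {x y : Space d} (hy : y ∈ minimizers F ψ x)
    (z : Space d) : ψ z ≤ ψ x + inner ℝ (x - y) (z - x) + ‖z - x‖ ^ 2 / 2 := by
  have h1 := hψ.mem_minimizers_iff.1 hy
  have h2 := hψ.le_add z y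
  rw [genFun] at h1 h2
  have h3 : z - y = (x - y) + (z - x) := by abel
  rw [h3, norm_add_sq_real] at h2
  linarith

/-- The slope |x - y| in the semiconcavity inequality is at most 2√ψ(x), so its right side is at
most (√ψ(x) + |z - x|)². -/
theorem sqrt_le_add (hF : IsKickPotential F) (hψ : IsStationarySolution F ψ) (x z : Space d) :
    √(ψ z) ≤ √(ψ x) + ‖z - x‖ := by
  obtain ⟨y, hy⟩ := hψ.exists_mem_minimizers x
  have h1 := hψ.le_add_inner hy z
  have h2 := real_inner_le_norm (x - y) (z - x)
  have h3 := Real.mul_self_sqrt (hψ.nonneg hF x)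
  have h4 : ‖x - y‖ ≤ 2 * √(ψ x) := by
    refine le_of_sq_le_sq ?_ (by positivity)
    nlinarith [hψ.kinetic_le hF hy, hψ.nonneg hF x]
  rw [Real.sqrt_le_left (by positivity)]
  nlinarith [norm_nonneg (z - x), mul_le_mul_of_nonneg_right h4 (norm_nonneg (z - x)),
    sq_nonneg ‖z - x‖]

theorem abs_sqrt_sub_le (hF : IsKickPotential F) (hψ : IsStationarySolution F ψ) (x z : Space d) :
    |√(ψ x) - √(ψ z)| ≤ ‖((x - z : Space d) : Torus d)‖ := by
  refine QuotientAddGroup.le_norm_iff.2 fun m hm => ?_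
  have hx : ψ x = ψ (z + m) := by
    refine hψ.periodic.eq_of_coe_eq ?_
    rw [QuotientAddGroup.mk_add, hm, ← QuotientAddGroup.mk_add, add_sub_cancel]
  have h1 := hψ.sqrt_le_add hF z (z + m)
  have h2 := hψ.sqrt_le_add hF (z + m) z
  rw [add_sub_cancel_left] at h1
  rw [sub_add_cancel_left, norm_neg] at h2
  rw [hx, abs_le]
  constructor <;> linarith

theorem hasFDerivAt_upper {x y : Space d} (a : ℝ) :
    HasFDerivAt (fun z : Space d => a + inner ℝ (x - y) (z - x) + ‖z - x‖ ^ 2 / 2)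
      (InnerProductSpace.toDual ℝ (Space d) (x - y)) x := by
  have h1 : HasFDerivAt (fun z : Space d => a + inner ℝ (x - y) (z - x))
      (InnerProductSpace.toDual ℝ (Space d) (x - y)) x :=
    ((InnerProductSpace.toDual ℝ (Space d) (x - y)).hasFDerivAt.comp x
      ((hasFDerivAt_id x).sub_const x)).const_add a
  have h2 := hasGradientAt_iff_hasFDerivAt.1 (hasGradientAt_half_norm_sub_sq x x)
  rw [sub_self, _root_.map_zero] at h2
  simpa using h1.fun_add h2

theorem gradient_eq_of_mem (hψ : IsStationarySolution F ψ) {x y : Space d} (hx : x ∈ diffSet ψ)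
    (hy : y ∈ minimizers F ψ x) : gradient ψ x = x - y := by
  have h1 := hasFDerivAt_eq_of_le (DifferentiableAt.hasFDerivAt hx) (hasFDerivAt_upper (ψ x))
    (hψ.le_add_inner hy) (by simp)
  rw [gradient, h1, LinearIsometryEquiv.symm_apply_apply]

/-- At a minimizer y, the function ψ(x) - h(·, x) touches ψ from below, and the semiconcavity
parabola at y touches it from above. -/
theorem hasGradientAt_of_mem (hF : IsKickPotential F) (hψ : IsStationarySolution F ψ)
    {x y : Space d} (hy : y ∈ minimizers F ψ x) :
    HasGradientAt ψ (x - y - gradient F y) y := by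
  obtain ⟨y', hy'⟩ := hψ.exists_mem_minimizers y
  have h1 : HasFDerivAt (fun z => ψ x - genFun F z x)
      (InnerProductSpace.toDual ℝ (Space d) (x - y - gradient F y)) y := by
    have h2 := (((hasGradientAt_half_norm_sub_sq x y).hasFDerivAt).fun_add
      (hF.hasGradientAt y).hasFDerivAt).const_sub (ψ x)
    simp only [genFun]
    rw [show x - y - gradient F y = -((y - x) + gradient F y) by abel, map_neg, map_add]
    simpa only [norm_sub_rev] using h2
  refine hasGradientAt_iff_hasFDerivAt.2 (hasFDerivAt_of_squeeze h1 (hasFDerivAt_upper (ψ y))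
    (fun z => ?_) (hψ.le_add_inner hy') ?_ (by simp))
  · linarith [hψ.le_add x z]
  · linarith [hψ.mem_minimizers_iff.1 hy]

theorem minimizers_eq_singleton (hψ : IsStationarySolution F ψ) {x y : Space d}
    (hx : x ∈ diffSet ψ) (hy : y ∈ minimizers F ψ x) : minimizers F ψ x = {y} := by
  refine Subset.antisymm (fun z hz => ?_) (singleton_subset_iff.2 hy)
  have := (hψ.gradient_eq_of_mem hx hz).symm.trans (hψ.gradient_eq_of_mem hx hy)
  exact sub_right_injective this

/-- Being a minimizer is an equation between continuous functions, so it passes from the pseudograph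
to its closure. -/
theorem sub_mem_minimizers_of_mem_closure (hF : IsKickPotential F)
    (hψ : IsStationarySolution F ψ) {z : Space d × Space d} (hz : z ∈ closure (pseudograph ψ)) :
    z.1 - z.2 ∈ minimizers F ψ z.1 := by
  have hFc := hF.contDiff.continuous
  have hψc := hψ.continuous
  have hclosed : IsClosed {z : Space d × Space d | z.1 - z.2 ∈ minimizers F ψ z.1} := by
    simp only [hψ.mem_minimizers_iff, genFun]
    exact isClosed_eq (by fun_prop) (by fun_prop)
  refine closure_minimal ?_ hclosed hz
  rintro _ ⟨x, hx, rfl⟩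
  obtain ⟨y, hy⟩ := hψ.exists_mem_minimizers x
  change x - gradient ψ x ∈ minimizers F ψ x
  rwa [hψ.gradient_eq_of_mem hx hy, sub_sub_cancel]

theorem diffSetMinus_subset (hF : IsKickPotential F) (hψ : IsStationarySolution F ψ) :
    diffSetMinus F ψ ⊆ diffSet ψ := by
  rintro _ ⟨_, ⟨z, hz, rfl⟩, rfl⟩
  exact (hψ.hasGradientAt_of_mem hF (hψ.sub_mem_minimizers_of_mem_closure hF hz)).differentiableAt

/-- Iterating minimizers yields a backward orbit. -/
theorem exists_minimizing_orbit (hF : IsKickPotential F) (hψ : IsStationarySolution F ψ)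
    {x y : Space d} (hy : y ∈ minimizers F ψ x) :
    ∃ v : ℕ → Space d, v 0 = x ∧ v 1 = y ∧ IsBackwardOrbit F v ∧
      ∀ n, v (n + 1) ∈ minimizers F ψ (v n) := by
  choose m hm using hψ.exists_mem_minimizers
  set v : ℕ → Space d := fun n => Nat.casesOn n x fun k => m^[k] y with hv
  have hmem : ∀ n, v (n + 1) ∈ minimizers F ψ (v n) := fun n => by
    cases n with
    | zero => exact hy
    | succ n =>
      change m^[n + 1] y ∈ minimizers F ψ (m^[n] y)
      rw [Function.iterate_succ_apply']
      exact hm _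
  refine ⟨v, rfl, rfl, fun n => ?_, hmem⟩
  -- The point v (n + 1) is a minimizer, hence a point of differentiability. Equating the two
  -- expressions of ∇ψ there, as a minimizer and as a point with a minimizer, gives the recurrence.
  have h1 := hψ.hasGradientAt_of_mem hF (hmem n)
  have h2 := hψ.gradient_eq_of_mem h1.differentiableAt (hmem (n + 1))
  rw [h1.gradient] at h2
  have h3 : v (n + 2) = v (n + 1) - (v n - v (n + 1) - gradient F (v (n + 1))) := by
    rw [h2, sub_sub_cancel]
  rw [h3, two_smul]
  abel

theorem orbit_decay (hF : IsKickPotential F) (hψ : IsStationarySolution F ψ) {c : ℝ} (hc : 0 < c)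
    (hgrow : ∀ y : Space d, c * ‖(y : Torus d)‖ ^ 2 ≤ F y) {v : ℕ → Space d}
    (hv : ∀ n, v (n + 1) ∈ minimizers F ψ (v n)) (n : ℕ) :
    ψ (v n) ≤ ((1 + 2 * c)⁻¹) ^ n * ψ (v 0) := by
  induction n with
  | zero => simp
  | succ n ih =>
    rw [pow_succ', mul_assoc]
    exact (hψ.contraction hF hc hgrow (hv n)).trans
      (mul_le_mul_of_nonneg_left ih (by positivity))

/-- Where `ψ` is small, the minimizers point into the local unstable manifold. -/
theorem proj_mem_localUnstable (hF : IsKickPotential F) (hψ : IsStationarySolution F ψ) {c : ℝ}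
    (hc : 0 < c) (hgrow : ∀ y : Space d, c * ‖(y : Torus d)‖ ^ 2 ≤ F y) {ε : ℝ} (hε : 0 < ε)
    {x y : Space d} (hy : y ∈ minimizers F ψ x)
    (hx : ψ x < min (1 / 4) (c / 2) * ε ^ 2) :
    proj (x, x - y) ∈ localUnstable (torusTwistMap F hF.periodic) (0, 0) ε := by
  obtain ⟨v, rfl, rfl, hvo, hvm⟩ := hψ.exists_minimizing_orbit hF hy
  have hm : 0 < min (1 / 4) (c / 2) := by positivity
  have hdec := hψ.orbit_decay hF hc hgrow hvm
  have hq0 : 0 < (1 + 2 * c)⁻¹ := by positivity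
  have hq1 : (1 + 2 * c)⁻¹ < 1 := inv_lt_one_of_one_lt₀ (by linarith)
  have hle : ∀ n, ψ (v n) ≤ ψ (v 0) := fun n => (hdec n).trans
    (mul_le_of_le_one_left (hψ.nonneg hF _) (pow_le_one₀ hq0.le hq1.le))
  have hlim : Tendsto (fun n => ψ (v n)) atTop (𝓝 0) := by
    refine squeeze_zero (fun n => hψ.nonneg hF _) hdec ?_
    simpa using (tendsto_pow_atTop_nhds_zero_of_lt_one hq0.le hq1).mul_const (ψ (v 0))
  have hpos : ∀ n, ‖(v n : Torus d)‖ ^ 2 ≤ (min (1 / 4) (c / 2))⁻¹ * ψ (v n) := fun n => by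
    rw [inv_mul_eq_div, le_div_iff₀ hm, mul_comm]
    exact hψ.lower_bound hF hc hgrow _
  have hkin : ∀ n, ‖v n - v (n + 1)‖ ^ 2 ≤ 2 * ψ (v n) := fun n => hψ.kinetic_le hF (hvm n)
  have hiter : ∀ n, ((torusTwistMap F hF.periodic).symm : _ → _)^[n] (proj (v 0, v 0 - v 1)) =
      proj (v n, v n - v (n + 1)) := fun n => by
    rw [torusTwistMap_symm_iterate_proj, twistMap_symm_iterate hvo]
  have hsq : ∀ (f : ℕ → ℝ), (∀ n, 0 ≤ f n) → Tendsto (fun n => f n ^ 2) atTop (𝓝 0) →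
      Tendsto f atTop (𝓝 0) := fun f hf h => by
    have := h.sqrt
    rw [Real.sqrt_zero] at this
    exact this.congr fun n => Real.sqrt_sq (hf n)
  refine ⟨fun n => ?_, ?_⟩
  · rw [hiter, dist_proj_lt_iff]
    -- This threshold bounds the position through `lower_bound` and the momentum through
    -- `kinetic_le`, as 2ψ < ε²/2.
    have h1 : ψ (v n) < min (1 / 4) (c / 2) * ε ^ 2 := (hle n).trans_lt hx
    refine ⟨lt_of_pow_lt_pow_left₀ 2 hε.le ((hpos n).trans_lt ?_),
      lt_of_pow_lt_pow_left₀ 2 hε.le ((hkin n).trans_lt ?_)⟩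
    · rwa [inv_mul_eq_div, div_lt_iff₀' hm]
    · have h2 := mul_le_mul_of_nonneg_right (min_le_left (1 / 4) (c / 2)) (sq_nonneg ε)
      nlinarith [sq_nonneg ε]
  · simp only [hiter]
    have h1 : Tendsto (fun n => ‖(v n : Torus d)‖) atTop (𝓝 0) :=
      hsq _ (fun n => norm_nonneg _) (squeeze_zero (fun n => sq_nonneg _) hpos
        (by rw [← mul_zero (min (1 / 4) (c / 2))⁻¹]; exact hlim.const_mul _))
    have h2 : Tendsto (fun n => ‖v n - v (n + 1)‖) atTop (𝓝 0) :=
      hsq _ (fun n => norm_nonneg _) (squeeze_zero (fun n => sq_nonneg _) hkin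
        (by simpa using hlim.const_mul 2))
    exact (tendsto_zero_iff_norm_tendsto_zero.2 h1).prodMk_nhds
      (tendsto_zero_iff_norm_tendsto_zero.2 h2)

end IsStationarySolution

end Stationary

/-! ### Identification of ∇ψ with the unstable manifold near the origin -/

section LocalStructure

variable {d : ℕ} {F ψ : Space d → ℝ} {ρ C : ℝ} {u : Space d → ConvSeq (Space d)}
  {S : Space d →L[ℝ] Space d}

/-- The momentum of the unstable manifold. -/
def chartMomentum (u : Space d → ConvSeq (Space d)) (x : Space d) : Space d :=
  x - u x ((1 : ℕ) : OnePoint ℕ)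

theorem IsUnstableChart.contDiffOn_momentum (h : IsUnstableChart F ρ C u S) :
    ContDiffOn ℝ 2 (chartMomentum u) (Metric.ball 0 ρ) :=
  contDiffOn_id.sub ((termCLM (Space d) 1).contDiff.comp_contDiffOn h.contDiffOn)

theorem IsUnstableChart.momentum_zero (h : IsUnstableChart F ρ C u S) :
    chartMomentum u 0 = 0 := by
  simp [chartMomentum, h.map_zero]

/-- The minimizing orbit puts (x, x - y) on W^u, and smallness removes the lattice ambiguity of the
lift. The momentum is thus forced to be that of the chart. -/
theorem mem_unstableDomain_of_minimizer (hF : IsKickPotential F) (hψ : IsStationarySolution F ψ)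
    (h : IsUnstableChart F ρ C u S) {ε : ℝ} (hε0 : 0 < ε) (hε : ε ≤ ρ) {c : ℝ} (hc : 0 < c)
    (hgrow : ∀ y : Space d, c * ‖(y : Torus d)‖ ^ 2 ≤ F y) {x y : Space d}
    (hy : y ∈ minimizers F ψ x) (hx : ψ x < min (1 / 4) (c / 2) * ε ^ 2) (hxε : ‖x‖ < ε) :
    x ∈ unstableDomain ρ ε u ∧ x - y = chartMomentum u x := by
  have h1 := hψ.proj_mem_localUnstable hF hc hgrow hε0 hy hx
  rw [h.localUnstable_eq hF.periodic hε] at h1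
  obtain ⟨_, ⟨x', hx', rfl⟩, heq⟩ := h1
  have h2 := (Prod.ext_iff.1 heq)
  obtain rfl : x' = x := eq_of_coe_eq_of_norm h2.1 (by
    linarith [h.norm_lt_of_mem_domain hx', h.le])
  exact ⟨hx', h2.2.symm⟩

/-- The position of the image of a point of the unstable manifold. -/
def chartForward (F : Space d → ℝ) (u : Space d → ConvSeq (Space d)) (x : Space d) : Space d :=
  x + (chartMomentum u x + gradient F x)

/-- The local unstable manifold is forward invariant near the origin. -/
theorem IsUnstableChart.apply_one_of_forward (h : IsUnstableChart F ρ C u S) {ε : ℝ} (hε : ε ≤ ρ)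
    {x : Space d} (hx : x ∈ unstableDomain ρ ε u) (hx' : ‖chartForward F u x‖ < ε)
    (hdx : ‖chartForward F u x - x‖ < ε) :
    u (chartForward F u x) ((1 : ℕ) : OnePoint ℕ) = x := by
  set x' := chartForward F u x with heq
  have hxρ : ‖x‖ < ρ := mem_ball_zero_iff.1 hx.1
  have h0 := h.initial x hxρ
  -- Putting the forward image in front of the orbit of x gives another small convergent backward
  -- orbit, which uniqueness identifies with the chart orbit of x'.
  obtain ⟨v, hv0, hvs⟩ : ∃ v : ℕ → Space d, v 0 = x' ∧ ∀ n : ℕ, v (n + 1) = u x n :=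
    ⟨fun n => Nat.casesOn n x' fun k => u x k, rfl, fun _ => rfl⟩
  have hv1 : v 1 = x := (hvs 0).trans h0
  have hvo : IsBackwardOrbit F v := fun n => by
    cases n with
    | zero =>
      rw [zero_add, zero_add, hv1, hv0, hvs 1, two_smul, heq, chartForward, chartMomentum]
      abel
    | succ n =>
      have h1 := h.orbit x hxρ n
      simp only [← hvs] at h1
      exact h1
  have hlim : Tendsto v atTop (𝓝 0) := by
    have h1 := tendsto_convSeq (u x)
    rw [h.limit x hxρ] at h1
    refine (tendsto_add_atTop_iff_nat 1).1 ?_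
    simpa only [hvs] using h1
  obtain ⟨-, h1⟩ := h.mem_domain_of_orbit hε hvo (fun n => by
      cases n with
      | zero => rwa [hv0]
      | succ n => rw [hvs]; exact ((u x).norm_coe_le_norm _).trans_lt hx.2.1)
    (fun n => by
      cases n with
      | zero => rwa [zero_add, hv1, hv0]
      | succ n =>
        rw [hvs, hvs]
        exact (ContinuousMap.norm_coe_le_norm (u x - shift (Space d) (u x)) n).trans_lt hx.2.2)
    hlim
  rw [← hv0, h1 1, hv1]

/-- Any minimizer y for the forward image x' satisfies x' - y = w(x'), and forward invariance gives
w(x') = x' - x; hence y = x. -/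
theorem mem_minimizers_chartForward (hF : IsKickPotential F) (hψ : IsStationarySolution F ψ)
    (h : IsUnstableChart F ρ C u S) {ε : ℝ} (hε0 : 0 < ε) (hε : ε ≤ ρ) {c : ℝ} (hc : 0 < c)
    (hgrow : ∀ y : Space d, c * ‖(y : Torus d)‖ ^ 2 ≤ F y) {x : Space d}
    (hx : x ∈ unstableDomain ρ ε u)
    (hψx : ψ (chartForward F u x) < min (1 / 4) (c / 2) * ε ^ 2) (hx' : ‖chartForward F u x‖ < ε)
    (hdx : ‖chartForward F u x - x‖ < ε) : x ∈ minimizers F ψ (chartForward F u x) := by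
  obtain ⟨y, hy⟩ := hψ.exists_mem_minimizers (chartForward F u x)
  have h2 := (mem_unstableDomain_of_minimizer hF hψ h hε0 hε hc hgrow hy hψx hx').2
  have h3 := h.apply_one_of_forward hε hx hx' hdx
  rw [chartMomentum, h3] at h2
  have h4 : y = x := sub_right_inj.1 h2
  rwa [h4] at hy

theorem hasGradientAt_of_mem_chartForward (hF : IsKickPotential F)
    (hψ : IsStationarySolution F ψ) {x : Space d} (hx : x ∈ minimizers F ψ (chartForward F u x)) :
    HasGradientAt ψ (chartMomentum u x) x := by
  have h1 := hψ.hasGradientAt_of_mem hF hx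
  rwa [chartForward, add_sub_cancel_left, add_sub_cancel_right] at h1

theorem mem_diffSetMinus (hψ : IsStationarySolution F ψ) {x y : Space d} (hx : x ∈ diffSet ψ)
    (hy : y ∈ minimizers F ψ x) : y ∈ diffSetMinus F ψ := by
  refine ⟨_, ⟨(x, gradient ψ x), subset_closure ⟨x, hx, rfl⟩, rfl⟩, ?_⟩
  change x - gradient ψ x = y
  rw [hψ.gradient_eq_of_mem hx hy, sub_sub_cancel]

/-- Near the origin, every point is the minimizer of its image under the dynamics on the unstable
manifold, and the gradient of `ψ` parametrizes the unstable manifold. -/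
theorem eventually_local_structure (hF : IsKickPotential F) (hψ : IsStationarySolution F ψ)
    (h : IsUnstableChart F ρ C u S) {ε : ℝ} (hε0 : 0 < ε) (hε : ε ≤ ρ) :
    ∀ᶠ x in 𝓝 (0 : Space d), x ∈ unstableDomain ρ ε u ∧ x ∈ diffSetMinus F ψ ∧
      HasGradientAt ψ (chartMomentum u x) x := by
  obtain ⟨c, hc, hgrow⟩ := hF.exists_growth
  have hsmall : ∀ᶠ x in 𝓝 (0 : Space d), ψ x < min (1 / 4) (c / 2) * ε ^ 2 ∧ ‖x‖ < ε := by
    refine (hψ.continuous.continuousAt.eventually_lt_const ?_).and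
      (continuous_norm.continuousAt.eventually_lt_const ?_)
    · rw [hψ.map_zero]; positivity
    · simpa using hε0
  have hwc : ContinuousAt (chartMomentum u) 0 :=
    h.contDiffOn_momentum.continuousOn.continuousAt (Metric.ball_mem_nhds 0 h.pos)
  have hgc : ContinuousAt (gradient F) 0 := hF.contDiff_gradient.continuous.continuousAt
  have hf0 : Tendsto (chartForward F u) (𝓝 0) (𝓝 0) := by
    have : ContinuousAt (chartForward F u) 0 := continuousAt_id.add (hwc.add hgc)
    simpa [ContinuousAt, chartForward, h.momentum_zero, hF.gradient_zero] using this
  have hdom : ∀ᶠ x in 𝓝 (0 : Space d), x ∈ unstableDomain ρ ε u :=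
    (h.isOpen_domain ε).mem_nhds (h.zero_mem_domain hε0)
  have hdist : ∀ᶠ x in 𝓝 (0 : Space d), ‖chartForward F u x - x‖ < ε :=
    (hf0.sub tendsto_id).norm.eventually_lt_const (by simpa using hε0)
  have hmin : ∀ᶠ x in 𝓝 (0 : Space d), x ∈ minimizers F ψ (chartForward F u x) := by
    exact ((hf0.eventually hsmall).and (hdom.and hdist)).mono fun x hx =>
      mem_minimizers_chartForward hF hψ h hε0 hε hc hgrow hx.2.1 hx.1.1 hx.1.2 hx.2.2
  have hgrad : ∀ᶠ x in 𝓝 (0 : Space d), HasGradientAt ψ (chartMomentum u x) x :=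
    hmin.mono fun x hx => hasGradientAt_of_mem_chartForward hF hψ hx
  -- The gradient claim is used at x and also at its forward image: differentiability at the image
  -- is what places x in `diffSetMinus F ψ`.
  exact (hdom.and (hmin.and (hgrad.and (hf0.eventually hgrad)))).mono fun x hx =>
    ⟨hx.1, mem_diffSetMinus hψ hx.2.2.2.differentiableAt hx.2.1, hx.2.2.1⟩

theorem mem_torusPseudograph_iff_of_small (hF : IsKickPotential F)
    (hψ : IsStationarySolution F ψ) (h : IsUnstableChart F ρ C u S) {ε : ℝ} (hε : ε ≤ ρ)
    {r : ℝ} (hr : ∀ x ∈ Metric.ball (0 : Space d) r, x ∈ unstableDomain ρ ε u ∧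
      x ∈ diffSetMinus F ψ ∧ HasGradientAt ψ (chartMomentum u x) x) :
    {z ∈ torusPseudograph ψ | ‖z.1‖ < r} =
      {z ∈ localUnstable (torusTwistMap F hF.periodic) (0, 0) ε | ‖z.1‖ < r} := by
  rw [h.localUnstable_eq hF.periodic hε]
  ext z
  constructor
  · rintro ⟨⟨_, ⟨x, -, rfl⟩, rfl⟩, hz⟩
    refine ⟨?_, hz⟩
    obtain ⟨x', hx', hx'r⟩ := exists_lift_of_norm_lt (show ‖(x : Torus d)‖ < r from hz)
    obtain ⟨h1, -, h2⟩ := hr x' (mem_ball_zero_iff.2 hx'r)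
    have hper : IsPeriodic (gradient ψ) := fun x k hk => gradient_add_of_mem hψ.periodic x hk
    refine ⟨_, ⟨x', h1, rfl⟩, Prod.ext hx' ?_⟩
    change chartMomentum u x' = gradient ψ x
    rw [← hper.eq_of_coe_eq hx', h2.gradient]
  · rintro ⟨⟨_, ⟨x, hx, rfl⟩, rfl⟩, hz⟩
    refine ⟨?_, hz⟩
    have h1 : ‖(x : Torus d)‖ < r := hz
    rw [norm_torus_eq (by linarith [h.norm_lt_of_mem_domain hx, h.le])] at h1
    have h2 := (hr x (mem_ball_zero_iff.2 h1)).2.2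
    refine ⟨_, ⟨x, h2.differentiableAt, rfl⟩, ?_⟩
    simp only [h2.gradient]
    rfl

theorem contDiffOn_three_of_gradient {w : Space d → Space d} {s : Set (Space d)} (hs : IsOpen s)
    (hψ : ∀ x ∈ s, HasGradientAt ψ (w x) x) (hw : ContDiffOn ℝ 2 w s) :
    ContDiffOn ℝ 3 ψ s ∧ ∀ x ∈ s, ‖iteratedFDeriv ℝ 2 ψ x‖ = ‖iteratedFDeriv ℝ 1 w x‖ := by
  have hfd : ∀ x ∈ s, fderiv ℝ ψ x = (InnerProductSpace.toDual ℝ (Space d) ∘ w) x :=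
    fun x hx => (hψ x hx).hasFDerivAt.fderiv
  constructor
  · rw [show (3 : WithTop ℕ∞) = 2 + 1 by norm_num, contDiffOn_succ_iff_fderiv_of_isOpen hs]
    refine ⟨fun x hx => (hψ x hx).differentiableAt.differentiableWithinAt, by simp, ?_⟩
    exact ((LinearIsometryEquiv.contDiff _).comp_contDiffOn hw).congr hfd
  · intro x hx
    have h1 : fderiv ℝ ψ =ᶠ[𝓝 x] InnerProductSpace.toDual ℝ (Space d) ∘ w :=
      (hs.eventually_mem hx).mono hfd
    rw [← norm_iteratedFDeriv_fderiv, (h1.iteratedFDeriv ℝ 1).eq_of_nhds,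
      LinearIsometryEquiv.norm_iteratedFDeriv_comp_left]

/-- Since ψ ≤ d/2 everywhere, N contractions bring every minimizing orbit below the threshold for
W^u; the single index k = N serves all points. -/
theorem torusPseudograph_subset_iUnion (hF : IsKickPotential F) (hψ : IsStationarySolution F ψ)
    {c : ℝ} (hc : 0 < c) (hgrow : ∀ y : Space d, c * ‖(y : Torus d)‖ ^ 2 ≤ F y) {ε : ℝ}
    (hε : 0 < ε) {N : ℕ} (hN : (1 + 2 * c)⁻¹ ^ N * (d / 2) < min (1 / 4) (c / 2) * ε ^ 2)
    {K : ℝ} (hNK : (N : ℝ) < K) :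
    torusPseudograph ψ ⊆ ⋃ (k : ℕ) (_ : (k : ℝ) < K), (torusTwistMap F hF.periodic)^[k] ''
      localUnstable (torusTwistMap F hF.periodic) (0, 0) ε := by
  rintro _ ⟨_, ⟨x, hx, rfl⟩, rfl⟩
  obtain ⟨y, hy⟩ := hψ.exists_mem_minimizers x
  simp only [hψ.gradient_eq_of_mem hx hy]
  obtain ⟨v, rfl, rfl, hvo, hvm⟩ := hψ.exists_minimizing_orbit hF hy
  refine mem_iUnion₂.2 ⟨N, hNK, proj (v N, v N - v (N + 1)), ?_, ?_⟩
  · refine hψ.proj_mem_localUnstable hF hc hgrow hε (hvm N) (lt_of_le_of_lt ?_ hN)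
    exact (hψ.orbit_decay hF hc hgrow hvm N).trans
      (mul_le_mul_of_nonneg_left (hψ.le_dim hF _) (by positivity))
  · rw [← twistMap_symm_iterate hvo, ← torusTwistMap_symm_iterate_proj hF.periodic]
    exact (Function.LeftInverse.iterate (torusTwistMap F hF.periodic).apply_symm_apply N) _

end LocalStructure

end KickedHJ

end

theorem mainTheorem8 {d : ℕ} (F : Space d → ℝ) (hF : IsKickPotential F) :
    -- hyperbolicity of the fixed point `(0, 0)`, through the derivative of the lift
    torusTwistMap F hF.periodic (0, 0) = (0, 0) ∧
    DifferentiableAt ℝ (twistMap F) (0, 0) ∧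
    IsHyperbolic (fderiv ℝ (twistMap F) (0, 0)) ∧
    ∃ ε₀ > (0 : ℝ), ∀ ε : ℝ, 0 < ε → ε < ε₀ →
    ∃ C > (1 : ℝ),
    -- the local unstable manifold is `C²`, with tangent plane at `(0, 0)` the graph of `S`
    (∃ (V : Set (Space d)) (w : Space d → Space d) (S : Matrix (Fin d) (Fin d) ℝ),
      IsOpen V ∧ 0 ∈ V ∧ V ⊆ Metric.ball 0 (1 / 2) ∧
      ContDiffOn ℝ 2 w V ∧
      (∀ i : ℕ, i ≤ 2 → ∀ x ∈ V, ‖iteratedFDeriv ℝ i w x‖ ≤ C) ∧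
      localUnstable (torusTwistMap F hF.periodic) (0, 0) ε
        = proj '' ((fun x => (x, w x)) '' V) ∧
      S.PosDef ∧
      tangentConeAt ℝ ((fun x => (x, w x)) '' V) ((0, 0) : Space d × Space d)
        = Set.range fun h : Space d => (h, Matrix.toEuclideanCLM (𝕜 := ℝ) S h)) ∧
    ∀ ψ : Space d → ℝ, IsStationarySolution F ψ →
      (∃ r > (0 : ℝ),
        {z ∈ torusPseudograph ψ | ‖z.1‖ < r}
          = {z ∈ localUnstable (torusTwistMap F hF.periodic) (0, 0) ε | ‖z.1‖ < r} ∧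
        Metric.ball 0 r ⊆ diffSetMinus F ψ ∧
        diffSetMinus F ψ ⊆ diffSet ψ ∧
        ContDiffOn ℝ 3 ψ (Metric.ball 0 r) ∧
        ∀ x ∈ Metric.ball (0 : Space d) r, ‖iteratedFDeriv ℝ 2 ψ x‖ ≤ C) ∧
      (∀ x : Space d, C⁻¹ * ‖(x : Torus d)‖ ^ 2 ≤ ψ x) ∧
      (∀ x y : Space d, |√(ψ x) - √(ψ y)| ≤ C * ‖((x - y : Space d) : Torus d)‖) ∧
      torusPseudograph ψ ⊆
        ⋃ (k : ℕ) (_ : (k : ℝ) < C), (torusTwistMap F hF.periodic)^[k] ''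
          localUnstable (torusTwistMap F hF.periodic) (0, 0) ε ∧
      ∃ κ : ℝ, 0 < κ ∧ κ < 1 ∧
        ∀ x ∈ diffSet ψ, ∃ y, minimizers F ψ x = {y} ∧ ψ y ≤ κ ^ 2 * ψ x := by

  obtain ⟨hhyp, ρ, B, u, S, hu, hSsym, hSpos⟩ := exists_isUnstableChart hF
  obtain ⟨M, hM, rfl⟩ := exists_posDef_matrix S hSsym hSpos
  obtain ⟨c, hc, hgrow⟩ := hF.exists_growth
  have hq0 : 0 < (1 + 2 * c)⁻¹ := by positivity
  have hq1 : (1 + 2 * c)⁻¹ < 1 := inv_lt_one_of_one_lt₀ (by linarith)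
  -- The threshold ε₀ is the radius of the chart, fixed before ψ is introduced.
  refine ⟨?_, (hasFDerivAt_twistMap hF).differentiableAt, hhyp, ρ, hu.pos, fun ε hε0 hερ => ?_⟩
  · change torusTwistMap F hF.periodic (proj (0, 0)) = proj (0, 0)
    rw [torusTwistMap_proj]
    simp [twistMap, hF.gradient_zero]
  set m := min (1 / 4) (c / 2)
  have hm : 0 < m := by positivity
  -- Adding 1 to d/2 avoids division by zero when d = 0.
  obtain ⟨N, hN⟩ := exists_pow_lt_of_lt_one (show 0 < m * ε ^ 2 / (d / 2 + 1) by positivity) hq1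
  have hN' : (1 + 2 * c)⁻¹ ^ N * (d / 2) < m * ε ^ 2 := by
    rw [lt_div_iff₀ (by positivity)] at hN
    refine lt_of_le_of_lt ?_ hN
    exact mul_le_mul_of_nonneg_left (by linarith) (by positivity)
  have hmi : 0 < m⁻¹ := inv_pos.2 hm
  have hB := abs_nonneg B
  have hB' := le_abs_self B
  have hN0 : (0 : ℝ) ≤ N := N.cast_nonneg
  -- The terms serve in turn the derivative bounds of w, the quadratic lower bound of ψ, the number
  -- of iterates, and both C > 1 and the Lipschitz constant 1 of √ψ.
  refine ⟨|B| + m⁻¹ + N + 1, by linarith, ?_, fun ψ hψ => ?_⟩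
  · refine ⟨unstableDomain ρ ε u, chartMomentum u, M, hu.isOpen_domain ε, hu.zero_mem_domain hε0,
      fun x hx => ?_, hu.contDiffOn_momentum.mono inter_subset_left, fun i hi x hx => ?_,
      hu.localUnstable_eq hF.periodic hερ.le, hM, ?_⟩
    · rw [mem_ball_zero_iff]
      linarith [hu.norm_lt_of_mem_domain hx, hu.le]
    · exact (hu.bound i hi x (mem_ball_zero_iff.1 hx.1)).trans (by linarith)
    · exact tangentConeAt_graph ((hu.isOpen_domain ε).mem_nhds (hu.zero_mem_domain hε0))
        hu.hasFDerivAt hu.momentum_zero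
  · obtain ⟨r, hr, hball⟩ := Metric.eventually_nhds_iff_ball.1
      (eventually_local_structure hF hψ hu hε0 hερ.le)
    obtain ⟨h3, hnorm⟩ := contDiffOn_three_of_gradient Metric.isOpen_ball
      (fun x hx => (hball x hx).2.2)
      (hu.contDiffOn_momentum.mono fun x hx => (hball x hx).1.1)
    refine ⟨⟨r, hr, mem_torusPseudograph_iff_of_small hF hψ hu hερ.le hball,
      fun x hx => (hball x hx).2.1, hψ.diffSetMinus_subset hF, h3, fun x hx => ?_⟩,
      fun x => ?_, fun x y => ?_,
      torusPseudograph_subset_iUnion hF hψ hc hgrow hε0 hN' (by linarith),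
      √(1 + 2 * c)⁻¹, Real.sqrt_pos.2 hq0, ?_, fun x hx => ?_⟩
    · rw [hnorm x hx]
      exact (hu.bound 1 (by norm_num) x (mem_ball_zero_iff.1 (hball x hx).1.1)).trans (by linarith)
    · refine le_trans ?_ (hψ.lower_bound hF hc hgrow x)
      exact mul_le_mul_of_nonneg_right (inv_le_of_inv_le₀ hm (by linarith)) (sq_nonneg _)
    · exact (hψ.abs_sqrt_sub_le hF x y).trans
        (le_mul_of_one_le_left (norm_nonneg _) (by linarith))
    · rw [Real.sqrt_lt' one_pos, one_pow]
      exact hq1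
    · obtain ⟨y, hy⟩ := hψ.exists_mem_minimizers x
      refine ⟨y, hψ.minimizers_eq_singleton hx hy, ?_⟩
      rw [Real.sq_sqrt hq0.le]
      exact hψ.contraction hF hc hgrow hy
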